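/- Fix a point $\infty \in S^3$ and let $u\colon S^3 \to S^3$ be a smooth involution with $u(\infty)=\infty$ that has a fixed point in $\mathbb{R}^3 = S^3\setminus\{\infty\}$ and whose differential at every fixed point in $\mathbb{R}^3$ is diagonalizable as $[1]\oplus[-1]\oplus[-1]$. Orient $S^3$ in the standard way. A ($u$-)invariant contact structure on $S^3$ is a plane field $\xi = \ker\alpha$, where $\alpha$ is a global smooth $1$-form on $S^3$ with $\alpha\wedge d\alpha > 0$, such that $u^*\xi=\xi$ and $u^*\alpha=-\alpha$. Let $\xi_t$, $t\in[0,1]$, be a smooth family of invariant contact structures on $S^3$ (i.e. locally on $[0,1]\times S^3$ the planes $\xi_t(x)$ are the kernels of $1$-forms on $S^3$ depending smoothly on $(t,x)$). Then there exists a smooth isotopy $\psi_t$, $t\in[0,1]$, of $S^3$, starting at $\psi_0=\mathrm{id}$, which is equivariant, i.e. $\psi_t\circ u = u\circ\psi_t$ for all $t\in[0,1]$, and such that $T\psi_t(\xi_0)=\xi_t$ for all $t\in[0,1]$. -/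

import Mathlib

open scoped Manifold ContDiff

noncomputable section

namespace InvContact

/-- The unit sphere `S³ ⊆ ℝ⁴`, with Mathlib's structure of a smooth `3`-manifold. -/
abbrev S3 : Type := Metric.sphere (0 : EuclideanSpace ℝ (Fin 4)) 1

/-- The tangent space `T_x S³`. -/
abbrev TS (x : S3) : Type := TangentSpace (𝓡 3) x

/-- The differential at `x` of the inclusion `S³ → ℝ⁴`. -/
def dIncl (x : S3) : TS x →L[ℝ] EuclideanSpace ℝ (Fin 4) :=
  mvfderiv (𝓡 3) (fun y : S3 => (y : EuclideanSpace ℝ (Fin 4))) x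

/-- `(v₁, v₂, v₃)` is a positive basis of `T_x S³` for the standard orientation of `S³`, as the
boundary of the unit ball of `ℝ⁴` (outward normal first). -/
def PosOriented (x : S3) (v₁ v₂ v₃ : TS x) : Prop :=
  0 < Matrix.det (Matrix.of
    (fun i j : Fin 4 => ![(x : EuclideanSpace ℝ (Fin 4)), dIncl x v₁, dIncl x v₂, dIncl x v₃] i j))

/-- A (not necessarily smooth) `1`-form on `S³`. -/
abbrev OneForm : Type := (x : S3) → TS x →L[ℝ] ℝ

/-- A (not necessarily smooth) field of linear subspaces of the tangent spaces of `S³`. -/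
abbrev Distribution : Type := (x : S3) → Submodule ℝ (TS x)

/-- A `1`-form is smooth if it is smooth as a function on the total space `T S³`. -/
def OneForm.Smooth (α : OneForm) : Prop :=
  ContMDiff (𝓡 3).tangent 𝓘(ℝ, ℝ) ∞ (fun p : TangentBundle (𝓡 3) S3 => α p.1 p.2)

/-- The distribution `Ker α`. -/
def OneForm.kernel (α : OneForm) : Distribution := fun x => LinearMap.ker (α x).toLinearMap

/-- The expression of `α` in the chart `φ` of `S³` around `x`, that is the `1`-form
`(φ⁻¹)^* α` on (the target of `φ` in) `ℝ³`. -/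
def OneForm.inChart (α : OneForm) (x : S3) (y : EuclideanSpace ℝ (Fin 3)) :
    EuclideanSpace ℝ (Fin 3) →L[ℝ] ℝ :=
  (α ((extChartAt (𝓡 3) x).symm y)).comp
    (mfderiv 𝓘(ℝ, EuclideanSpace ℝ (Fin 3)) (𝓡 3) (extChartAt (𝓡 3) x).symm y)

/-- The exterior derivative `dα` at `x`, computed in the chart `φ` around `x`: if `a = (φ⁻¹)^* α`
then `da (v, w) = (D_v a) w - (D_w a) v`, and `dα = φ^* da`. -/
def OneForm.d (α : OneForm) (x : S3) (v w : TS x) : ℝ :=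
  let φ := extChartAt (𝓡 3) x
  let dφ : TS x →L[ℝ] EuclideanSpace ℝ (Fin 3) :=
    mvfderiv (𝓡 3) φ x
  fderiv ℝ (α.inChart x) (φ x) (dφ v) (dφ w) - fderiv ℝ (α.inChart x) (φ x) (dφ w) (dφ v)

/-- The `3`-form `α ∧ dα`. -/
def OneForm.wedgeD (α : OneForm) (x : S3) (v₁ v₂ v₃ : TS x) : ℝ :=
  α x v₁ * α.d x v₂ v₃ + α x v₂ * α.d x v₃ v₁ + α x v₃ * α.d x v₁ v₂

/-- A positive contact form on `S³`: a smooth `1`-form with `α ∧ dα > 0`. -/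
structure OneForm.IsContact (α : OneForm) : Prop where
  smooth : α.Smooth
  pos : ∀ (x : S3) (v₁ v₂ v₃ : TS x), PosOriented x v₁ v₂ v₃ → 0 < α.wedgeD x v₁ v₂ v₃

/-- The involutions under consideration: smooth involutions of `S³ = ℝ³ ∪ {∞}` fixing `∞`, with a
fixed point in `ℝ³`, and whose differential at every fixed point in `ℝ³` is diagonalizable as
`[1] ⊕ [-1] ⊕ [-1]`. (The tangent spaces at `u p` and `p = u p` are compared inside `ℝ⁴`.) -/
structure IsAdmissibleInvolution (infty : S3) (u : S3 → S3) : Prop where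
  smooth : ContMDiff (𝓡 3) (𝓡 3) ∞ u
  involutive : Function.Involutive u
  fix_infty : u infty = infty
  exists_fixed : ∃ p : S3, p ≠ infty ∧ u p = p
  diagonalizable : ∀ p : S3, p ≠ infty → u p = p →
    ∃ b : Module.Basis (Fin 3) ℝ (TS p), ∀ i : Fin 3,
      dIncl (u p) (mfderiv (𝓡 3) (𝓡 3) u p (b i)) = (![1, -1, -1] i : ℝ) • dIncl p (b i)

/-- `ξ` is a (positively cooriented) `u`-invariant contact structure: `ξ = Ker α` for a positive
contact form `α` on `S³` with `u^* ξ = ξ` and `u^* α = -α`. -/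
def IsInvariantContactStructure (u : S3 → S3) (ξ : Distribution) : Prop :=
  ∃ α : OneForm, α.IsContact ∧ ξ = α.kernel ∧
    (∀ x : S3, (ξ (u x)).comap (mfderiv (𝓡 3) (𝓡 3) u x).toLinearMap = ξ x) ∧
    (∀ (x : S3) (v : TS x), α (u x) (mfderiv (𝓡 3) (𝓡 3) u x v) = -α x v)

/-- The plane fields `ξ t`, `t ∈ [0,1]`, form a smooth family: near every `(t₀, x₀)` they are the
kernels of `1`-forms depending smoothly on `(t, x)`. Smoothness on `[0,1] × S³` at the end points
`t = 0, 1` means, as usual, smoothness of a local extension. -/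
def IsSmoothFamily (ξ : ℝ → Distribution) : Prop :=
  ∀ t₀ ∈ Set.Icc (0 : ℝ) 1, ∀ x₀ : S3,
    ∃ U : Set (ℝ × S3), IsOpen U ∧ (t₀, x₀) ∈ U ∧
    ∃ β : ℝ → OneForm,
      ContMDiffOn (𝓘(ℝ, ℝ).prod (𝓡 3).tangent) 𝓘(ℝ, ℝ) ∞
        (fun p : ℝ × TangentBundle (𝓡 3) S3 => β p.1 p.2.1 p.2.2) {p | (p.1, p.2.1) ∈ U} ∧
      ∀ t ∈ Set.Icc (0 : ℝ) 1, ∀ x : S3, (t, x) ∈ U → ξ t x = (β t).kernel x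

/-- `ψ t`, `t ∈ [0,1]`, is a smooth isotopy of `S³`, starting at the identity, and commuting
with `u`. As above, smoothness on `[0,1] × S³` is smoothness on a neighbourhood of it. -/
structure IsEquivariantIsotopy (u : S3 → S3) (ψ : ℝ → S3 → S3) : Prop where
  smooth : ∃ O : Set ℝ, IsOpen O ∧ Set.Icc (0 : ℝ) 1 ⊆ O ∧
    ContMDiffOn (𝓘(ℝ, ℝ).prod (𝓡 3)) (𝓡 3) ∞ (fun p : ℝ × S3 => ψ p.1 p.2) (O ×ˢ Set.univ)
  diffeo : ∀ t ∈ Set.Icc (0 : ℝ) 1, ∃ Ψ : S3 ≃ₘ^∞⟮𝓡 3, 𝓡 3⟯ S3, ⇑Ψ = ψ t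
  start : ψ 0 = id
  equivariant : ∀ t ∈ Set.Icc (0 : ℝ) 1, ψ t ∘ u = u ∘ ψ t

end InvContact

end

-- This is Gray stability by Moser's method. If `α_t` defines `ξ_t`, the equation `(∂_t α_t + ι_X
-- dα_t)|ξ_t = 0` has exactly one solution `X` in `ξ_t`, because `dα_t` is nondegenerate on the
-- contact planes; the flow of `X_t` carries `ξ_0` to `ξ_t`. Rescaling `α_t` by a function
-- multiplies the equation, restricted to `ξ_t`, by that function. So `X_t` depends on the planes
-- alone: local defining forms suffice, and a diffeomorphism preserving every `ξ_t` preserves `X_t`.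
-- Equivariance of the flow then follows from uniqueness of integral curves, without averaging.
--
-- To compute in linear coordinates, `ξ_t` is pulled back along the radial projection to a
-- homothety-invariant hyperplane field on `ℝ⁴ ∖ 0`. There the radial direction is degenerate, and
-- `X` is normalised by requiring it to be orthogonal to the position vector; its flow then
-- preserves the norm and restricts to the sphere.
--
-- The main steps are smooth dependence of flows on initial data (`exists_smooth_flow`, by the
-- implicit function theorem on a space of paths), uniqueness and local smoothness of `X`
-- (`eq_of_isGrayVector`, `exists_local_gray`), gluing (`exists_vectorField`), naturality
-- (`IsSymmetry.isGrayVector`) and preservation of the planes (`mem_of_flow`). These give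
-- `IsConicContact.exists_isotopy`, which `isConicContact` and `isSymmetry_coneMap` make applicable
-- to the sphere.

universe u

/-! ### Smooth operators on spaces of continuous paths. -/

namespace SmoothFlow

open Set Filter
open scoped Topology

section Nemytskii

variable {K : Type*} [TopologicalSpace K] [CompactSpace K]

/-- Pointwise application `C(K, E →L F) → C(K, E) → C(K, F)`, as a bounded bilinear map. -/
noncomputable def applyL (K E F : Type*) [TopologicalSpace K] [CompactSpace K]
    [NormedAddCommGroup E] [NormedSpace ℝ E] [NormedAddCommGroup F] [NormedSpace ℝ F] :
    C(K, E →L[ℝ] F) →L[ℝ] C(K, E) →L[ℝ] C(K, F) :=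
  LinearMap.mkContinuous₂
    (LinearMap.mk₂ ℝ (fun (A : C(K, E →L[ℝ] F)) (h : C(K, E)) =>
        (⟨fun s => A s (h s), A.continuous.clm_apply h.continuous⟩ : C(K, F)))
      (fun _ _ _ => by ext; simp) (fun _ _ _ => by ext; simp)
      (fun _ _ _ => by ext; simp) (fun _ _ _ => by ext; simp)) 1
    (fun A h => by
      rw [one_mul]
      refine (ContinuousMap.norm_le _ (by positivity)).2 fun s => ?_
      exact ((A s).le_opNorm _).trans (mul_le_mul (A.norm_coe_le_norm s) (h.norm_coe_le_norm s)
        (norm_nonneg _) (norm_nonneg A)))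

/-- The Nemytskii operator `γ ↦ f ∘ γ` is differentiable if `f` is continuously differentiable. -/
lemma hasFDerivAt_comp_continuousMap {E F : Type*} [NormedAddCommGroup E] [NormedSpace ℝ E]
    [NormedAddCommGroup F] [NormedSpace ℝ F] {f : E → F} {f' : E → E →L[ℝ] F}
    (hf : Continuous f) (hf' : ∀ x, HasFDerivAt f (f' x) x) (hc : Continuous f') (γ : C(K, E)) :
    HasFDerivAt (fun γ : C(K, E) => (⟨f, hf⟩ : C(E, F)).comp γ)
      (applyL K E F ((⟨f', hc⟩ : C(E, E →L[ℝ] F)).comp γ)) γ := by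
  rw [hasFDerivAt_iff_isLittleO_nhds_zero, Asymptotics.isLittleO_iff]
  intro ε hε
  have hcont : Continuous fun γ : C(K, E) => (⟨f', hc⟩ : C(E, E →L[ℝ] F)).comp γ :=
    ContinuousMap.continuous_postcomp _
  obtain ⟨δ, hδ, hδ'⟩ := Metric.continuous_iff (α := C(K, E)) (β := C(K, E →L[ℝ] F))
    |>.1 hcont γ ε hε
  filter_upwards [Metric.ball_mem_nhds (0 : C(K, E)) hδ] with h hh
  rw [mem_ball_zero_iff] at hh
  refine (ContinuousMap.norm_le _ (by positivity)).2 fun s => ?_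
  -- A bound uniform in `s`: the operator induced by `f'` is continuous at `γ` for the sup norm, and
  -- it is tested on the translate of `γ` by the constant `z - γ s`. The mean value inequality on
  -- the ball then applies.
  have key : ∀ z ∈ Metric.ball (γ s) δ, ‖f' z - f' (γ s)‖ ≤ ε := by
    intro z hz
    have h1 : dist (γ + ContinuousMap.const K (z - γ s)) γ < δ := by
      rw [dist_eq_norm, add_sub_cancel_left]
      refine (ContinuousMap.norm_lt_iff _ hδ).2 fun _ => ?_
      simpa [dist_eq_norm] using hz
    have h2 := (ContinuousMap.dist_le hε.le).1 (hδ' _ h1).le s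
    simpa [dist_eq_norm] using h2
  have hmem : γ s + h s ∈ Metric.ball (γ s) δ := by
    rw [Metric.mem_ball, dist_eq_norm, add_sub_cancel_left]
    exact (h.norm_coe_le_norm s).trans_lt hh
  have := (convex_ball (γ s) δ).norm_image_sub_le_of_norm_hasFDerivWithin_le'
    (fun z _ => (hf' z).hasFDerivWithinAt) key (Metric.mem_ball_self hδ) hmem
  rw [add_sub_cancel_left] at this
  exact this.trans (mul_le_mul_of_nonneg_left (h.norm_coe_le_norm s) hε.le)

/-- Induction on `n`: the derivative is the same kind of operator for `fderiv ℝ f`, followed by the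
bounded linear map `applyL`. The target `F` therefore varies in the induction, passing to `E →L[ℝ]
F`, which is why both spaces share a universe. -/
lemma contDiff_comp_continuousMap_nat {E : Type u} [NormedAddCommGroup E] [NormedSpace ℝ E]
    (n : ℕ) : ∀ {F : Type u} [NormedAddCommGroup F] [NormedSpace ℝ F] {f : E → F}
    (hf : ContDiff ℝ n f),
    ContDiff ℝ n (fun γ : C(K, E) => (⟨f, hf.continuous⟩ : C(E, F)).comp γ) := by
  induction n with
  | zero =>
    intro F _ _ f hf
    exact contDiff_zero.2 (ContinuousMap.continuous_postcomp _)
  | succ n ih =>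
    intro F _ _ f hf
    have h1 : ContDiff ℝ n (fderiv ℝ f) :=
      hf.fderiv_right (by norm_cast)
    have hd : ∀ γ : C(K, E), HasFDerivAt
        (fun γ : C(K, E) => (⟨f, hf.continuous⟩ : C(E, F)).comp γ)
        (applyL K E F ((⟨fderiv ℝ f, h1.continuous⟩ : C(E, E →L[ℝ] F)).comp γ)) γ := fun γ =>
      hasFDerivAt_comp_continuousMap hf.continuous
        (fun x => (hf.differentiable (by norm_cast)).differentiableAt.hasFDerivAt) h1.continuous γ
    refine contDiff_succ_iff_hasFDerivAt (n := n) |>.2 ⟨_, ?_, hd⟩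
    exact (applyL K E F).contDiff.comp (ih h1)

/-- The Nemytskii operator of a smooth map is smooth. -/
lemma contDiff_comp_continuousMap {E : Type u} [NormedAddCommGroup E] [NormedSpace ℝ E]
    {F : Type u} [NormedAddCommGroup F] [NormedSpace ℝ F] {f : E → F} (hf : ContDiff ℝ ∞ f) :
    ContDiff ℝ ∞ (fun γ : C(K, E) => (⟨f, hf.continuous⟩ : C(E, F)).comp γ) :=
  contDiff_infty.2 fun n => contDiff_comp_continuousMap_nat n (contDiff_infty.1 hf n)

end Nemytskii

section Volterra

variable (E : Type*) [NormedAddCommGroup E] [NormedSpace ℝ E]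

/-- The operator `γ ↦ (s ↦ ∫₀ˢ γ)` on `C([0,1], E)`. -/
noncomputable def volterra : C(unitInterval, E) →L[ℝ] C(unitInterval, E) :=
  LinearMap.mkContinuous
    { toFun := fun γ => ⟨fun s => ∫ τ in (0 : ℝ)..s, IccExtend zero_le_one γ τ,
        (intervalIntegral.continuous_primitive
          (fun _ _ => (γ.continuous.Icc_extend').intervalIntegrable _ _) 0).comp
          continuous_subtype_val⟩
      map_add' := fun γ η => by
        ext s
        exact intervalIntegral.integral_add
          ((γ.continuous.Icc_extend' (h := zero_le_one)).intervalIntegrable _ _)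
          ((η.continuous.Icc_extend' (h := zero_le_one)).intervalIntegrable _ _)
      map_smul' := fun c γ => by
        ext s
        exact intervalIntegral.integral_smul c (IccExtend zero_le_one γ) } 1
    (fun γ => by
      rw [one_mul]
      refine (ContinuousMap.norm_le _ (norm_nonneg _)).2 fun s => ?_
      refine (intervalIntegral.norm_integral_le_of_norm_le_const
        (fun τ _ => γ.norm_coe_le_norm (projIcc 0 1 zero_le_one τ))).trans ?_
      rw [sub_zero, abs_of_nonneg s.2.1]
      exact mul_le_of_le_one_right (norm_nonneg _) s.2.2)

lemma volterra_apply (γ : C(unitInterval, E)) (s : unitInterval) :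
    volterra E γ s = ∫ τ in (0 : ℝ)..s, IccExtend zero_le_one γ τ := rfl

end Volterra

end SmoothFlow

/-! ### Global smooth flows of bounded Lipschitz vector fields. -/

namespace SmoothFlow

open Set Filter
open scoped Topology

variable {E : Type u} [NormedAddCommGroup E] [NormedSpace ℝ E]

lemma exists_global_solution [CompleteSpace E] {f : E → E} (hf : ContDiff ℝ ∞ f) {K L : NNReal}
    (hK : LipschitzWith K f) (hL : ∀ x, ‖f x‖ ≤ L) (x : E) :
    ∃ γ : ℝ → E, γ 0 = x ∧ ∀ t, HasDerivAt γ (f (γ t)) t := by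
  have hv : ContMDiff 𝓘(ℝ, E) 𝓘(ℝ, E).tangent 1
      (fun x : E => (⟨x, f x⟩ : TangentBundle 𝓘(ℝ, E) E)) :=
    contMDiff_vectorSpace_iff_contDiff.2 (hf.of_le (by norm_cast))
  obtain ⟨γ, h0, hγ⟩ := exists_isMIntegralCurve_of_isMIntegralCurveOn
    (I := 𝓘(ℝ, E)) (v := f) hv one_pos (fun y => by
      -- With speed at most `L`, a curve stays within distance `L` of `y` during unit time. The
      -- existence time `1` is thus the same at every point, which allows local solutions to be
      -- continued for ever.
      have hp : IsPicardLindelof (fun _ => f) (tmin := -1) (tmax := 1) ⟨0, by simp⟩ y L 0 L K :=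
        { lipschitzOnWith := fun _ _ => hK.lipschitzOnWith
          continuousOn := fun _ _ => continuousOn_const
          norm_le := fun _ _ z _ => hL z
          mul_max_le := by simp }
      obtain ⟨α, h0, hα⟩ := hp.exists_eq_forall_mem_Icc_hasDerivWithinAt₀
      refine ⟨α, h0, fun t ht => ?_⟩
      exact ((hα t (Ioo_subset_Icc_self ht)).mono Ioo_subset_Icc_self).hasFDerivWithinAt
        |>.hasMFDerivWithinAt) x
  exact ⟨γ, h0, fun t => by
    have h : HasFDerivAt γ ((1 : ℝ →L[ℝ] ℝ).smulRight (f (γ t))) t := (hγ t).hasFDerivAt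
    simpa using h.hasDerivAt⟩

/-- Constant functions, as a bounded linear map `E → C([0,1], E)`. -/
noncomputable def constL (E : Type u) [NormedAddCommGroup E] [NormedSpace ℝ E] :
    E →L[ℝ] C(unitInterval, E) :=
  LinearMap.mkContinuous
    { toFun := fun x => ContinuousMap.const _ x
      map_add' := fun _ _ => rfl
      map_smul' := fun _ _ => rfl } 1
    (fun x => by
      rw [one_mul]
      exact (ContinuousMap.norm_le _ (norm_nonneg _)).2 fun s => le_rfl)

@[simp] lemma constL_apply (x : E) (s : unitInterval) : constL E x s = x := rfl

lemma norm_flow_sub_le {f : E → E} {L : ℝ} (hL : ∀ x, ‖f x‖ ≤ L)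
    {γ : ℝ → E} (hγ : ∀ t, HasDerivAt γ (f (γ t)) t) (t : ℝ) : ‖γ t - γ 0‖ ≤ L * |t| := by
  have := convex_univ.norm_image_sub_le_of_norm_hasDerivWithin_le (s := (univ : Set ℝ)) (x := 0)
    (y := t) (fun s _ => (hγ s).hasDerivWithinAt) (fun s _ => hL (γ s)) (mem_univ _) (mem_univ _)
  simpa using this

/-- The flow of a smooth bounded vector field is smooth at time `0`. -/
lemma contDiffAt_flow_zero [CompleteSpace E] {f : E → E} (hf : ContDiff ℝ ∞ f) {L : ℝ}
    (hL : ∀ x, ‖f x‖ ≤ L)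
    {φ : ℝ → E → E} (h0 : ∀ x, φ 0 x = x) (hφ : ∀ x t, HasDerivAt (φ · x) (f (φ t x)) t) (x₀ : E) :
    ContDiffAt ℝ ∞ (fun p : ℝ × E => φ p.1 p.2) (0, x₀) := by
  let N : C(unitInterval, E) → C(unitInterval, E) :=
    fun γ => (⟨f, hf.continuous⟩ : C(E, E)).comp γ
  have hN : ContDiff ℝ ∞ N := contDiff_comp_continuousMap hf
  -- After rescaling time to `[0,1]`, the integral equation of the trajectory from `x` up to time
  -- `t` reads `γ = x + t ∫ f ∘ γ`, that is `G = 0`. At `t = 0` the derivative of `G` in `γ` is the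
  -- identity.
  let G : (ℝ × E) × C(unitInterval, E) → C(unitInterval, E) :=
    fun p => p.2 - constL E p.1.2 - p.1.1 • volterra E (N p.2)
  have hG : ContDiff ℝ ∞ G := by
    have h1 : ContDiff ℝ ∞ fun p : (ℝ × E) × C(unitInterval, E) => N p.2 := hN.comp contDiff_snd
    have h2 : ContDiff ℝ ∞ fun p : (ℝ × E) × C(unitInterval, E) => volterra E (N p.2) :=
      (volterra E).contDiff.comp h1
    have h3 : ContDiff ℝ ∞ fun p : (ℝ × E) × C(unitInterval, E) => constL E p.1.2 :=
      (constL E).contDiff.comp (contDiff_snd.comp contDiff_fst)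
    exact (contDiff_snd.sub h3).sub ((contDiff_fst.comp contDiff_fst).smul h2)
  let u : (ℝ × E) × C(unitInterval, E) := ((0, x₀), constL E x₀)
  have hu : G u = 0 := by simp [G, u]
  have hinv : (fderiv ℝ G u ∘L .inr ℝ (ℝ × E) C(unitInterval, E)).IsInvertible := by
    have hd : HasFDerivAt G (fderiv ℝ G u) u :=
      (hG.differentiable (by simp)).differentiableAt.hasFDerivAt
    have h1 : HasFDerivAt (fun γ => G ((0, x₀), γ))
        (fderiv ℝ G u ∘L .inr ℝ (ℝ × E) C(unitInterval, E)) (constL E x₀) :=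
      HasFDerivAt.comp (constL E x₀) hd (hasFDerivAt_prodMk_right (0, x₀) (constL E x₀))
    have h2 : HasFDerivAt (fun γ => G ((0, x₀), γ)) (.id ℝ C(unitInterval, E)) (constL E x₀) := by
      have : (fun γ => G ((0, x₀), γ)) = fun γ => γ - constL E x₀ := by
        funext γ; simp [G]
      rw [this]
      exact (hasFDerivAt_id _).sub_const _
    rw [h1.unique h2]
    exact ⟨.refl ℝ _, rfl⟩
  have hGu : ContDiffAt ℝ ∞ G u := hG.contDiffAt
  have hne : (∞ : ℕ∞ω) ≠ 0 := by simp
  let Γ : ℝ × E → C(unitInterval, E) := fun p =>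
    ⟨fun s => φ (p.1 * s) p.2,
      (continuous_iff_continuousAt.2 fun t => (hφ p.2 t).continuousAt).comp
        (continuous_const.mul continuous_subtype_val)⟩
  have hΓ : ∀ p, G (p, Γ p) = 0 := by
    intro p
    ext s
    have hc : Continuous fun t => φ t p.2 :=
      continuous_iff_continuousAt.2 fun t => (hφ p.2 t).continuousAt
    have hder : ∀ τ : ℝ, HasDerivAt (fun τ => φ (p.1 * τ) p.2) (p.1 • f (φ (p.1 * τ) p.2)) τ := by
      intro τ
      have := (hφ p.2 (p.1 * τ)).scomp τ ((hasDerivAt_id τ).const_mul p.1)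
      simpa using! this
    have hcont : Continuous fun τ => p.1 • f (φ (p.1 * τ) p.2) :=
      continuous_const.smul (hf.continuous.comp (hc.comp (continuous_const.mul continuous_id)))
    have hint := intervalIntegral.integral_eq_sub_of_hasDerivAt (a := 0) (b := (s : ℝ))
      (fun τ _ => hder τ) (hcont.intervalIntegrable _ _)
    rw [intervalIntegral.integral_smul, mul_zero, h0] at hint
    have hv : volterra E (N (Γ p)) s = ∫ τ in (0 : ℝ)..s, f (φ (p.1 * τ) p.2) := by
      rw [volterra_apply]
      refine intervalIntegral.integral_congr fun τ hτ => ?_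
      rw [uIcc_of_le s.2.1] at hτ
      have hτ' : τ ∈ Icc (0 : ℝ) 1 := ⟨hτ.1, hτ.2.trans s.2.2⟩
      change IccExtend zero_le_one (N (Γ p)) τ = _
      rw [IccExtend_of_mem _ _ hτ']
      rfl
    change Γ p s - p.2 - p.1 • volterra E (N (Γ p)) s = 0
    rw [hv, hint]
    simp [Γ]
  have hΓ0 : Γ (0, x₀) = constL E x₀ := by
    ext s; simp [Γ, h0]
  -- The implicit function theorem identifies only those solutions that are close to the constant
  -- path; the speed bound puts the trajectories there.
  have hΓc : ContinuousAt Γ (0, x₀) := by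
    rw [ContinuousAt, hΓ0, tendsto_iff_norm_sub_tendsto_zero]
    have hb : ∀ p : ℝ × E, ‖Γ p - constL E x₀‖ ≤ L * |p.1| + ‖p.2 - x₀‖ := by
      intro p
      have hLn : 0 ≤ L := (norm_nonneg _).trans (hL 0)
      refine (ContinuousMap.norm_le _ (by positivity)).2 fun s => ?_
      have h1 := norm_flow_sub_le hL (hφ p.2) (p.1 * s)
      rw [h0] at h1
      have h2 : L * |p.1 * s| ≤ L * |p.1| := by
        refine mul_le_mul_of_nonneg_left ?_ hLn
        rw [abs_mul, abs_of_nonneg s.2.1]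
        exact mul_le_of_le_one_right (abs_nonneg _) s.2.2
      calc ‖φ (p.1 * s) p.2 - x₀‖ = ‖(φ (p.1 * s) p.2 - p.2) + (p.2 - x₀)‖ := by
            rw [sub_add_sub_cancel]
        _ ≤ _ := (norm_add_le _ _).trans (by linarith)
    refine squeeze_zero (fun _ => norm_nonneg _) hb ?_
    have : Continuous fun p : ℝ × E => L * |p.1| + ‖p.2 - x₀‖ := by fun_prop
    simpa using this.tendsto (0, x₀)
  have hpair : Tendsto (fun p => (p, Γ p)) (𝓝 ((0 : ℝ), x₀)) (𝓝 u) := by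
    have := (continuousAt_id (x := ((0 : ℝ), x₀))).prodMk hΓc
    rw [ContinuousAt, hΓ0] at this
    exact this
  have hev := hpair.eventually (hGu.eventually_apply_eq_iff_implicitFunction hne hinv)
  have hsm := hGu.contDiffAt_implicitFunction hne hinv
  have := (ContinuousMap.evalCLM ℝ (1 : unitInterval) :
    C(unitInterval, E) →L[ℝ] E).contDiff.contDiffAt.comp _ hsm
  refine this.congr_of_eventuallyEq ?_
  filter_upwards [hev] with p hp
  have := hp.1 (by rw [hΓ, hu])
  simp only [Function.comp_apply]
  rw [this]
  simp [Γ]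

/-- A smooth, bounded, Lipschitz vector field has a smooth global flow. -/
theorem exists_smooth_flow [CompleteSpace E] {f : E → E} (hf : ContDiff ℝ ∞ f) {K L : NNReal}
    (hK : LipschitzWith K f) (hL : ∀ x, ‖f x‖ ≤ L) :
    ∃ φ : ℝ → E → E, (∀ x, φ 0 x = x) ∧ (∀ x t, HasDerivAt (φ · x) (f (φ t x)) t) ∧
      (∀ s t x, φ (s + t) x = φ s (φ t x)) ∧
      ContDiff ℝ ∞ (fun p : ℝ × E => φ p.1 p.2) := by
  choose γ h0 hγ using exists_global_solution hf hK hL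
  have hgroup : ∀ s t x, γ x (s + t) = γ (γ x t) s := by
    intro s t x
    have h1 : ∀ s, HasDerivAt (fun s => γ x (s + t)) (f (γ x (s + t))) s := fun s =>
      (hγ x (s + t)).comp_add_const s t
    have := ODE_solution_unique_univ (v := fun _ => f) (s := fun _ => univ) (K := K) (t₀ := 0)
      (f := fun s => γ x (s + t)) (g := γ (γ x t))
      (fun _ => hK.lipschitzOnWith) (fun s => ⟨h1 s, mem_univ _⟩)
      (fun s => ⟨hγ _ s, mem_univ _⟩) (by simp [h0])
    exact congrFun this s
  refine ⟨fun t x => γ x t, h0, hγ, hgroup, ?_⟩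
  -- A finite order `n` is fixed because being `C^n` at a point is then an open condition. Together
  -- with the group law this makes smoothness at `(t, x₀)` a locally constant property of `t`, and
  -- it holds at `t = 0`.
  refine contDiff_infty.2 fun n => contDiff_iff_contDiffAt.2 ?_
  rintro ⟨t₁, x₀⟩
  have hz : ∀ y, ContDiffAt ℝ n (fun p : ℝ × E => γ p.2 p.1) (0, y) := fun y =>
    (contDiffAt_flow_zero hf hL (φ := fun t x => γ x t) h0 hγ y).of_le (by exact_mod_cast le_top)
  let P : ℝ → Prop := fun t => ContDiffAt ℝ n (fun p : ℝ × E => γ p.2 p.1) (t, x₀)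
  have hP : IsLocallyConstant P := by
    rw [IsLocallyConstant.iff_eventually_eq]
    intro t
    have hstep : ∀ a b : ℝ, ContDiffAt ℝ n (fun p : ℝ × E => γ p.2 p.1) (b - a, γ x₀ a) →
        P a → P b := by
      intro a b h1 h2
      have h3 : ContDiffAt ℝ n (fun p : ℝ × E => γ p.2 a) (b, x₀) :=
        ContDiffAt.comp (g := fun p : ℝ × E => γ p.2 p.1) (f := fun p : ℝ × E => (a, p.2))
          (b, x₀) h2 (by fun_prop)
      have h4 : ContDiffAt ℝ n (fun p : ℝ × E => (p.1 - a, γ p.2 a)) (b, x₀) :=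
        ContDiffAt.prodMk (by fun_prop) h3
      have h5 := ContDiffAt.comp (g := fun p : ℝ × E => γ p.2 p.1)
        (f := fun p : ℝ × E => (p.1 - a, γ p.2 a)) (b, x₀) h1 h4
      refine h5.congr_of_eventuallyEq (Eventually.of_forall fun p => ?_)
      simp only [Function.comp_apply]
      rw [← hgroup, sub_add_cancel]
    have hev := (hz (γ x₀ t)).eventually (by simp)
    have hc : Continuous (γ x₀) := continuous_iff_continuousAt.2 fun t => (hγ x₀ t).continuousAt
    have e1 : ∀ᶠ s in 𝓝 t, ContDiffAt ℝ n (fun p : ℝ × E => γ p.2 p.1) (s - t, γ x₀ t) := by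
      have : Continuous fun s : ℝ => (s - t, γ x₀ t) := by fun_prop
      exact (this.tendsto' t (0, γ x₀ t) (by simp)).eventually hev
    have e2 : ∀ᶠ s in 𝓝 t, ContDiffAt ℝ n (fun p : ℝ × E => γ p.2 p.1) (t - s, γ x₀ s) := by
      have : Continuous fun s : ℝ => (t - s, γ x₀ s) := by fun_prop
      exact (this.tendsto' t (0, γ x₀ t) (by simp)).eventually hev
    filter_upwards [e1, e2] with s h1 h2
    exact propext ⟨hstep s t h2, hstep t s h1⟩
  have := hP.apply_eq_of_preconnectedSpace 0 t₁
  exact this.mp (hz x₀)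

end SmoothFlow

/-! ### Gray vectors of conic hyperplane fields and their uniqueness. -/

namespace ConicGray

open Set Filter
open scoped Topology RealInnerProductSpace

/-- If a differentiable function vanishes on a set with unique derivatives, its derivative
is `0`. -/
lemma hasFDerivAt_eq_zero {V W : Type*} [NormedAddCommGroup V] [NormedSpace ℝ V]
    [NormedAddCommGroup W] [NormedSpace ℝ W] {F : V → W} {F' : V →L[ℝ] W} {s : Set V} {p : V}
    (hs : UniqueDiffWithinAt ℝ s p) (hp : p ∈ s) (hF : HasFDerivAt F F' p)
    (h0 : ∀ᶠ q in 𝓝[s] p, F q = 0) : F' = 0 :=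
  hs.eq hF.hasFDerivWithinAt
    ((hasFDerivWithinAt_const (0 : W) p s).congr_of_eventuallyEq h0 (h0.self_of_nhdsWithin hp))

/-- Two families of linear forms with the same kernels have proportional derivatives on the
kernel. -/
lemma fderiv_apply_mul_comm {V E : Type*} [NormedAddCommGroup V] [NormedSpace ℝ V]
    [NormedAddCommGroup E] [NormedSpace ℝ E] {B B' : V → E →L[ℝ] ℝ} {s : Set V} {p : V}
    (hs : UniqueDiffWithinAt ℝ s p) (hp : p ∈ s) (hB : DifferentiableAt ℝ B p)
    (hB' : DifferentiableAt ℝ B' p) (hker : ∀ᶠ q in 𝓝[s] p, ∀ w, B q w = 0 ↔ B' q w = 0)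
    {w : E} (hw : B p w = 0) (e : E) (v : V) :
    fderiv ℝ B' p v w * B p e = fderiv ℝ B p v w * B' p e := by
  have hw' : B' p w = 0 := (hker.self_of_nhdsWithin hp w).1 hw
  have h1 : ∀ a : E, HasFDerivAt (fun q => B q a) ((fderiv ℝ B p).flip a) p := fun a =>
    hB.hasFDerivAt.clm_apply (hasFDerivAt_const a p) |>.congr_fderiv (by ext; simp)
  have h2 : ∀ a : E, HasFDerivAt (fun q => B' q a) ((fderiv ℝ B' p).flip a) p := fun a =>
    hB'.hasFDerivAt.clm_apply (hasFDerivAt_const a p) |>.congr_fderiv (by ext; simp)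
  -- Proportional forms satisfy `B'(w) B(e) = B(w) B'(e)`. Differentiating this identity avoids
  -- choosing a proportionality factor and proving it differentiable.
  have h3 := hasFDerivAt_eq_zero hs hp (((h2 w).mul (h1 e)).sub ((h1 w).mul (h2 e)))
    (hker.mono fun q hq => by
      have := (hq (B q e • w - B q w • e)).1 (by simp [mul_comm])
      simp only [map_sub, map_smul, smul_eq_mul] at this
      simp only [Pi.sub_apply, Pi.mul_apply]
      linarith)
  have h4 := congrArg (fun L : V →L[ℝ] ℝ => L v) h3
  simp [hw, hw'] at h4
  linarith

lemma contDiffAt_clm_apply_iff {V E F : Type*} [NormedAddCommGroup V] [NormedSpace ℝ V]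
    [NormedAddCommGroup E] [NormedSpace ℝ E] [FiniteDimensional ℝ E] [NormedAddCommGroup F]
    [NormedSpace ℝ F] {n : ℕ∞ω} {f : V → E →L[ℝ] F} {q : V} :
    ContDiffAt ℝ n f q ↔ ∀ w, ContDiffAt ℝ n (fun x => f x w) q := by
  refine ⟨fun h w => h.clm_apply contDiffAt_const, fun h => ?_⟩
  let b := Module.finBasis ℝ E
  have hf : f = fun x => ∑ i, ContinuousLinearMap.smulRightL ℝ E F
      (LinearMap.toContinuousLinearMap (b.coord i)) (f x (b i)) := by
    funext x
    ext w
    have := congrArg (f x) (b.sum_repr w)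
    simp only [map_sum, map_smul] at this
    simp [← this]
  rw [hf]
  exact ContDiffAt.sum fun i _ => (ContinuousLinearMap.contDiff _).contDiffAt.comp q (h (b i))

variable {E : Type u} [NormedAddCommGroup E] [InnerProductSpace ℝ E]

/-- `B` is a family of linear forms, smooth near `p`, that defines the distribution `D` near `p`
at the times in `[0,1]`. -/
structure IsDefiningForm (D : ℝ × E → Submodule ℝ E) (p : ℝ × E) (B : ℝ × E → E →L[ℝ] ℝ) :
    Prop where
  smooth : ∀ᶠ q in 𝓝 p, ContDiffAt ℝ ∞ B q
  ker : ∀ᶠ q in 𝓝 p, q.1 ∈ Icc (0 : ℝ) 1 → ∀ w, w ∈ D q ↔ B q w = 0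

/-- The value at `p` of the vector field whose flow preserves the distribution `D`. -/
structure IsGrayVector (D : ℝ × E → Submodule ℝ E) (p : ℝ × E) (X : E) : Prop where
  mem : X ∈ D p
  orth : ⟪p.2, X⟫ = 0
  eq : ∀ B, IsDefiningForm D p B → ∀ w ∈ D p, fderiv ℝ B p (1, X) w = fderiv ℝ B p (0, w) X

/-- A smooth family `D (t, ·)`, `t ∈ [0,1]`, of hyperplane fields on `E \ 0`, invariant under
homotheties, that contain the radial direction and induce contact structures on the sphere. -/
structure IsConicContact (D : ℝ × E → Submodule ℝ E) : Prop where
  exists_form : ∀ t ∈ Icc (0 : ℝ) 1, ∀ y ≠ 0, ∃ B, IsDefiningForm D (t, y) B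
  conic : ∀ t ∈ Icc (0 : ℝ) 1, ∀ y ≠ 0, ∀ c : ℝ, 0 < c → D (t, c • y) = D (t, y)
  radial : ∀ t ∈ Icc (0 : ℝ) 1, ∀ y ≠ 0, y ∈ D (t, y)
  exists_notMem : ∀ t ∈ Icc (0 : ℝ) 1, ∀ y ≠ 0, ∃ e, e ∉ D (t, y)
  nondegenerate : ∀ t ∈ Icc (0 : ℝ) 1, ∀ y ≠ 0, ∃ A : E → E →L[ℝ] ℝ, DifferentiableAt ℝ A y ∧
    (∀ᶠ z in 𝓝 y, ∀ w, w ∈ D (t, z) ↔ A z w = 0) ∧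
    ∀ X ∈ D (t, y), ⟪y, X⟫ = 0 → (∀ w ∈ D (t, y), fderiv ℝ A y X w = fderiv ℝ A y w X) → X = 0

variable {D : ℝ × E → Submodule ℝ E} {p : ℝ × E} {B : ℝ × E → E →L[ℝ] ℝ}

namespace IsDefiningForm

lemma eventually (h : IsDefiningForm D p B) : ∀ᶠ q in 𝓝 p, IsDefiningForm D q B := by
  filter_upwards [eventually_eventually_nhds.2 h.smooth, eventually_eventually_nhds.2 h.ker]
    with q h1 h2 using ⟨h1, h2⟩

lemma mem_iff (h : IsDefiningForm D p B) (hp : p.1 ∈ Icc (0 : ℝ) 1) (w : E) :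
    w ∈ D p ↔ B p w = 0 :=
  h.ker.self_of_nhds hp w

lemma contDiffAt (h : IsDefiningForm D p B) : ContDiffAt ℝ ∞ B p := h.smooth.self_of_nhds

lemma differentiableAt (h : IsDefiningForm D p B) : DifferentiableAt ℝ B p :=
  h.contDiffAt.differentiableAt (by simp)

end IsDefiningForm

/-- Defining forms are controlled only at times in `[0,1]`. Unique differentiability of the slab
turns an identity valid there into one for full derivatives, also at the end times. -/
lemma uniqueDiffWithinAt_slab (hp : p.1 ∈ Icc (0 : ℝ) 1) :
    UniqueDiffWithinAt ℝ (Icc (0 : ℝ) 1 ×ˢ (univ : Set E)) p :=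
  ((uniqueDiffOn_Icc zero_lt_one).prod uniqueDiffOn_univ) p ⟨hp, mem_univ _⟩

lemma IsDefiningForm.fderiv_comm {B' : ℝ × E → E →L[ℝ] ℝ} (h : IsDefiningForm D p B)
    (h' : IsDefiningForm D p B') (hp : p.1 ∈ Icc (0 : ℝ) 1) {w : E} (hw : w ∈ D p) (e : E)
    (v : ℝ × E) : fderiv ℝ B' p v w * B p e = fderiv ℝ B p v w * B' p e := by
  refine fderiv_apply_mul_comm (uniqueDiffWithinAt_slab hp) ⟨hp, mem_univ _⟩ h.differentiableAt
    h'.differentiableAt ?_ ((h.mem_iff hp w).1 hw) e v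
  filter_upwards [mem_nhdsWithin_of_mem_nhds h.ker, mem_nhdsWithin_of_mem_nhds h'.ker,
    self_mem_nhdsWithin] with q h1 h2 h3 w
  rw [← h1 h3.1, ← h2 h3.1]

lemma IsDefiningForm.fderiv_slice (h : IsDefiningForm D p B) :
    HasFDerivAt (fun z => B (p.1, z)) ((fderiv ℝ B p).comp (.inr ℝ ℝ E)) p.2 :=
  HasFDerivAt.comp p.2 h.differentiableAt.hasFDerivAt (hasFDerivAt_prodMk_right p.1 p.2)

namespace IsConicContact

/-- Differentiate the identity `B q q.2 = 0`. With `fderiv_radial_apply`, which differentiates along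
a ray, this puts the radial vector in the kernel of `dB` restricted to `D`. -/
lemma fderiv_apply_radial (hD : IsConicContact D) (h : IsDefiningForm D p B)
    (hp : p.1 ∈ Icc (0 : ℝ) 1) (hp2 : p.2 ≠ 0) {X : E} (hX : X ∈ D p) (τ : ℝ) :
    fderiv ℝ B p (τ, X) p.2 = 0 := by
  have h1 := h.differentiableAt.hasFDerivAt.clm_apply (hasFDerivAt_snd (𝕜 := ℝ) (p := p))
  have h2 := hasFDerivAt_eq_zero (uniqueDiffWithinAt_slab hp) ⟨hp, mem_univ _⟩ h1 (by
    have : ∀ᶠ q : ℝ × E in 𝓝 p, q.2 ≠ 0 := continuousAt_snd.eventually_ne hp2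
    filter_upwards [mem_nhdsWithin_of_mem_nhds h.ker, self_mem_nhdsWithin,
      mem_nhdsWithin_of_mem_nhds this] with q h1 h2 h3
    exact (h1 h2.1 _).1 (hD.radial q.1 h2.1 q.2 h3))
  have h3 := congrArg (fun L : ℝ × E →L[ℝ] ℝ => L (τ, X)) h2
  simpa [(h.mem_iff hp X).1 hX] using h3

lemma fderiv_radial_apply (hD : IsConicContact D) (h : IsDefiningForm D p B)
    (hp : p.1 ∈ Icc (0 : ℝ) 1) (hp2 : p.2 ≠ 0) {X : E} (hX : X ∈ D p) :
    fderiv ℝ B p (0, p.2) X = 0 := by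
  have h1 : HasDerivAt (fun s : ℝ => (p.1, p.2 + s • p.2)) ((0 : ℝ), p.2) 0 := by
    refine (hasDerivAt_const _ _).prodMk ?_
    simpa using! ((hasDerivAt_id (0 : ℝ)).smul_const p.2).const_add p.2
  have hp0 : (p.1, p.2 + (0 : ℝ) • p.2) = p := by simp
  have h2 : HasDerivAt (fun s : ℝ => B (p.1, p.2 + s • p.2)) (fderiv ℝ B p (0, p.2)) 0 :=
    HasFDerivAt.comp_hasDerivAt (0 : ℝ) (l := B)
      (by rw [hp0]; exact h.differentiableAt.hasFDerivAt) h1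
  have h3 := h2.clm_apply (hasDerivAt_const 0 X)
  have hc : Tendsto (fun s : ℝ => (p.1, p.2 + s • p.2)) (𝓝 0) (𝓝 p) := by
    have : Continuous fun s : ℝ => (p.1, p.2 + s • p.2) := by fun_prop
    simpa using this.tendsto 0
  have h4 : (fun s : ℝ => B (p.1, p.2 + s • p.2) X) =ᶠ[𝓝 0] fun _ => 0 := by
    filter_upwards [hc.eventually h.ker, eventually_gt_nhds (show (-1 : ℝ) < 0 by norm_num)]
      with s h1 h2
    refine (h1 hp X).1 ?_
    have : p.2 + s • p.2 = (1 + s) • p.2 := by rw [add_smul, one_smul]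
    rw [this, hD.conic p.1 hp p.2 hp2 (1 + s) (by linarith)]
    exact hX
  have h5 := (h3.congr_of_eventuallyEq h4.symm).unique (hasDerivAt_const 0 (0 : ℝ))
  simpa using h5

/-- Nondegeneracy is given for some form `A` at a fixed time; on the kernel the derivatives of `A`
and `B` are proportional, so it passes to every defining form. -/
lemma eq_zero_of_fderiv_comm (hD : IsConicContact D) (h : IsDefiningForm D p B)
    (hp : p.1 ∈ Icc (0 : ℝ) 1) (hp2 : p.2 ≠ 0) {X : E} (hX : X ∈ D p) (ho : ⟪p.2, X⟫ = 0)
    (hc : ∀ w ∈ D p, fderiv ℝ B p (0, X) w = fderiv ℝ B p (0, w) X) : X = 0 := by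
  obtain ⟨A, hA, hker, hnd⟩ := hD.nondegenerate p.1 hp p.2 hp2
  obtain ⟨e, he⟩ := hD.exists_notMem p.1 hp p.2 hp2
  have hs : Tendsto (fun z => (p.1, z)) (𝓝 p.2) (𝓝 p) :=
    (Continuous.prodMk_right p.1).tendsto p.2
  have hcomm : ∀ v, ∀ w ∈ D p,
      fderiv ℝ A p.2 v w * B p e = fderiv ℝ B p (0, v) w * A p.2 e := by
    intro v w hw
    have := fderiv_apply_mul_comm (uniqueDiffWithinAt_univ (x := p.2)) (mem_univ _)
      h.fderiv_slice.differentiableAt hA (by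
        rw [nhdsWithin_univ]
        filter_upwards [hs.eventually h.ker, hker] with z h1 h2 w
        rw [← h1 hp, ← h2]) (w := w) ((h.mem_iff hp w).1 hw) e v
    rw [h.fderiv_slice.fderiv] at this
    simpa using this
  have hBe : B p e ≠ 0 := fun h0 => he ((h.mem_iff hp e).2 h0)
  refine hnd X hX ho fun w hw => mul_right_cancel₀ hBe ?_
  rw [hcomm X w hw, hcomm w X hX, hc w hw]

/-- In the difference of two Gray vectors the time derivative cancels, leaving a vector of `D`
orthogonal to the radius and in the kernel of `dB` on `D`. -/
lemma eq_of_isGrayVector (hD : IsConicContact D) (hp : p.1 ∈ Icc (0 : ℝ) 1) (hp2 : p.2 ≠ 0)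
    {X Y : E} (hX : IsGrayVector D p X) (hY : IsGrayVector D p Y) : X = Y := by
  obtain ⟨B, hB⟩ := hD.exists_form p.1 hp p.2 hp2
  refine sub_eq_zero.1 (hD.eq_zero_of_fderiv_comm hB hp hp2 (sub_mem hX.mem hY.mem) ?_ ?_)
  · rw [inner_sub_right, hX.orth, hY.orth, sub_zero]
  · intro w hw
    have h1 : ((0 : ℝ), X - Y) = (1, X) - (1, Y) := by simp
    rw [h1, map_sub, map_sub, _root_.sub_apply, hX.eq B hB w hw, hY.eq B hB w hw]

/-- One form is enough: changing the form multiplies both sides of the equation, on `D`, by the same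
factor. -/
lemma isGrayVector_of_form (hD : IsConicContact D) (h : IsDefiningForm D p B)
    (hp : p.1 ∈ Icc (0 : ℝ) 1) (hp2 : p.2 ≠ 0) {X : E} (hX : X ∈ D p) (ho : ⟪p.2, X⟫ = 0)
    (hc : ∀ w ∈ D p, fderiv ℝ B p (1, X) w = fderiv ℝ B p (0, w) X) : IsGrayVector D p X := by
  refine ⟨hX, ho, fun B' h' w hw => ?_⟩
  obtain ⟨e, he⟩ := hD.exists_notMem p.1 hp p.2 hp2
  have hBe : B p e ≠ 0 := fun h0 => he ((h.mem_iff hp e).2 h0)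
  refine mul_right_cancel₀ hBe ?_
  rw [h.fderiv_comm h' hp hw, h.fderiv_comm h' hp hX, hc w hw]

end IsConicContact

/-! ### Local existence and smoothness of Gray vectors. -/

section LinearSystem

/-- The linear system that defines the Gray vector, with two Lagrange multipliers. -/
noncomputable def grayMap (B : ℝ × E → E →L[ℝ] ℝ) (q : ℝ × E) :
    E × ℝ × ℝ →L[ℝ] (E →L[ℝ] ℝ) × ℝ × ℝ :=
  let M : E →L[ℝ] E →L[ℝ] ℝ := (fderiv ℝ B q).comp (.inr ℝ ℝ E)
  ((M - M.flip).comp (.fst ℝ E (ℝ × ℝ)) +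
    ((ContinuousLinearMap.fst ℝ ℝ ℝ).comp (.snd ℝ E (ℝ × ℝ))).smulRight (B q) +
    ((ContinuousLinearMap.snd ℝ ℝ ℝ).comp (.snd ℝ E (ℝ × ℝ))).smulRight (innerSL ℝ q.2)).prod
  (((B q).comp (.fst ℝ E (ℝ × ℝ))).prod ((innerSL ℝ q.2).comp (.fst ℝ E (ℝ × ℝ))))

lemma grayMap_apply (B : ℝ × E → E →L[ℝ] ℝ) (q : ℝ × E) (v : E × ℝ × ℝ) :
    grayMap B q v = ((fderiv ℝ B q (0, v.1) - ((fderiv ℝ B q).comp (.inr ℝ ℝ E)).flip v.1 +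
      v.2.1 • B q + v.2.2 • innerSL ℝ q.2), B q v.1, ⟪q.2, v.1⟫) := by
  simp [grayMap]

lemma grayMap_apply_fst (B : ℝ × E → E →L[ℝ] ℝ) (q : ℝ × E) (v : E × ℝ × ℝ) (w : E) :
    (grayMap B q v).1 w = fderiv ℝ B q (0, v.1) w - fderiv ℝ B q (0, w) v.1 +
      v.2.1 * B q w + v.2.2 * ⟪q.2, w⟫ := by
  simp [grayMap_apply]

lemma contDiffAt_grayMap [FiniteDimensional ℝ E] {B : ℝ × E → E →L[ℝ] ℝ} {q : ℝ × E}
    (hB : ContDiffAt ℝ ∞ B q) : ContDiffAt ℝ ∞ (grayMap B) q := by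
  have hB' : ContDiffAt ℝ ∞ (fderiv ℝ B) q := hB.fderiv_right (by simp)
  have key : ∀ v, ContDiffAt ℝ ∞ (fun q => grayMap B q v) q := by
    intro v
    simp only [grayMap_apply]
    refine ContDiffAt.prodMk ?_ (ContDiffAt.prodMk ?_ ?_)
    · refine ContDiffAt.add (ContDiffAt.add (ContDiffAt.sub ?_ ?_) ?_) ?_
      · exact hB'.clm_apply contDiffAt_const
      · have h1 : ContDiffAt ℝ ∞ (fun q => (fderiv ℝ B q).comp (.inr ℝ ℝ E)) q :=
          hB'.clm_comp contDiffAt_const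
        refine contDiffAt_clm_apply_iff.2 fun w => ?_
        exact (h1.clm_apply contDiffAt_const).clm_apply contDiffAt_const
      · exact contDiffAt_const.fun_smul hB
      · exact contDiffAt_const.fun_smul ((innerSL ℝ).contDiff.contDiffAt.comp q contDiffAt_snd)
    · exact hB.clm_apply contDiffAt_const
    · exact contDiffAt_snd.inner ℝ contDiffAt_const
  exact contDiffAt_clm_apply_iff.2 key

/-- The multipliers make the system square, so injectivity gives invertibility. Testing a kernel
element on the radial vector isolates `m`, testing on `D` gives `X = 0`, and testing on a transverse
`e` gives `l = 0`. -/
lemma IsConicContact.grayMap_injective (hD : IsConicContact D) (h : IsDefiningForm D p B)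
    (hp : p.1 ∈ Icc (0 : ℝ) 1) (hp2 : p.2 ≠ 0) : Function.Injective (grayMap B p) := by
  rw [injective_iff_map_eq_zero]
  rintro ⟨X, l, m⟩ hv
  have h1 : ∀ w, fderiv ℝ B p (0, X) w - fderiv ℝ B p (0, w) X + l * B p w + m * ⟪p.2, w⟫ = 0 :=
    fun w => by rw [← grayMap_apply_fst B p (X, l, m) w, hv]; simp
  rw [grayMap_apply] at hv
  have hX : X ∈ D p := (h.mem_iff hp X).2 (congrArg (fun a => a.2.1) hv)
  have ho : ⟪p.2, X⟫ = 0 := congrArg (fun a => a.2.2) hv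
  have hpp : ⟪p.2, p.2⟫ ≠ 0 := by simpa using hp2
  have hm : m = 0 := by
    have := h1 p.2
    rw [hD.fderiv_apply_radial h hp hp2 hX, hD.fderiv_radial_apply h hp hp2 hX,
      (h.mem_iff hp _).1 (hD.radial p.1 hp p.2 hp2)] at this
    simpa [hp2] using this
  subst hm
  have hX0 : X = 0 := by
    refine hD.eq_zero_of_fderiv_comm h hp hp2 hX ho fun w hw => ?_
    have := h1 w
    rw [(h.mem_iff hp w).1 hw] at this
    linarith
  subst hX0
  obtain ⟨e, he⟩ := hD.exists_notMem p.1 hp p.2 hp2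
  have hBe : B p e ≠ 0 := fun h0 => he ((h.mem_iff hp e).2 h0)
  have hl := h1 e
  have h00 : ((0 : ℝ), (0 : E)) = 0 := rfl
  simp [h00, hBe] at hl
  simp [hl]

variable [FiniteDimensional ℝ E]

/-- Gray vectors form, locally, a smooth time-dependent vector field. -/
lemma IsConicContact.exists_local_gray (hD : IsConicContact D) (hp : p.1 ∈ Icc (0 : ℝ) 1)
    (hp2 : p.2 ≠ 0) : ∃ g : ℝ × E → E, (∀ᶠ q in 𝓝 p, ContDiffAt ℝ ∞ g q ∧ ⟪q.2, g q⟫ = 0) ∧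
      ∀ᶠ q in 𝓝 p, q.1 ∈ Icc (0 : ℝ) 1 → IsGrayVector D q (g q) := by
  obtain ⟨B, hB⟩ := hD.exists_form p.1 hp p.2 hp2
  have hrank : Module.finrank ℝ (E × ℝ × ℝ) = Module.finrank ℝ ((E →L[ℝ] ℝ) × ℝ × ℝ) := by
    have : Module.finrank ℝ E = Module.finrank ℝ (E →L[ℝ] ℝ) :=
      (InnerProductSpace.toDual ℝ E).toLinearEquiv.finrank_eq
    simp [this]
  have hequiv : ∀ q, Function.Injective (grayMap B q) →
      ∃ e : (E × ℝ × ℝ) ≃L[ℝ] (E →L[ℝ] ℝ) × ℝ × ℝ,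
        (e : E × ℝ × ℝ →L[ℝ] (E →L[ℝ] ℝ) × ℝ × ℝ) = grayMap B q := by
    intro q hq
    let e := (LinearEquiv.ofInjectiveOfFinrankEq (grayMap B q).toLinearMap hq hrank)
    exact ⟨e.toContinuousLinearEquiv, ContinuousLinearMap.ext fun _ => rfl⟩
  let rhs : ℝ × E → (E →L[ℝ] ℝ) × ℝ × ℝ := fun q => (-fderiv ℝ B q (1, 0), 0, 0)
  obtain ⟨e, he⟩ := hequiv p (hD.grayMap_injective hB hp hp2)
  -- Invertibility is open, so the solution exists and is smooth also at nearby times outside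
  -- `[0,1]`, where the planes are unconstrained.
  have hopen : ∀ᶠ q in 𝓝 p, ∃ e : (E × ℝ × ℝ) ≃L[ℝ] (E →L[ℝ] ℝ) × ℝ × ℝ,
      (e : E × ℝ × ℝ →L[ℝ] (E →L[ℝ] ℝ) × ℝ × ℝ) = grayMap B q := by
    have := (ContinuousLinearEquiv.isOpen (𝕜 := ℝ) (E := E × ℝ × ℝ)
      (F := (E →L[ℝ] ℝ) × ℝ × ℝ)).mem_nhds ⟨e, he⟩
    exact (contDiffAt_grayMap hB.contDiffAt).continuousAt.eventually this
  refine ⟨fun q => ((grayMap B q).inverse (rhs q)).1, ?_, ?_⟩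
  · filter_upwards [hopen, hB.smooth] with q hq hBq
    obtain ⟨e', he'⟩ := hq
    have h1 : ContDiffAt ℝ ∞ (fun q => (grayMap B q).inverse) q := by
      refine ContDiffAt.comp q (g := ContinuousLinearMap.inverse) ?_ (contDiffAt_grayMap hBq)
      rw [← he']
      exact contDiffAt_map_inverse e'
    have h2 : ContDiffAt ℝ ∞ rhs q := by
      refine ContDiffAt.prodMk ?_ contDiffAt_const
      have := (hBq.fderiv_right (m := ∞) (by simp)).clm_apply
        (contDiffAt_const (c := ((1 : ℝ), (0 : E))))
      exact this.neg
    refine ⟨(h1.clm_apply h2).fst, ?_⟩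
    set v := (grayMap B q).inverse (rhs q) with hv
    have hsol : grayMap B q v = rhs q := by
      rw [hv, ← he', ContinuousLinearMap.inverse_equiv]
      simp
    rw [grayMap_apply] at hsol
    exact congrArg (fun a => a.2.2) hsol
  · have hne : ∀ᶠ q : ℝ × E in 𝓝 p, q.2 ≠ 0 := continuousAt_snd.eventually_ne hp2
    filter_upwards [hopen, hB.eventually, hne] with q hq hBq hq2 hq1
    obtain ⟨e', he'⟩ := hq
    set v := (grayMap B q).inverse (rhs q) with hv
    have hsol : grayMap B q v = rhs q := by
      rw [hv, ← he', ContinuousLinearMap.inverse_equiv]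
      simp
    have h1 : ∀ w, fderiv ℝ B q (0, v.1) w - fderiv ℝ B q (0, w) v.1 + v.2.1 * B q w +
        v.2.2 * ⟪q.2, w⟫ = - fderiv ℝ B q (1, 0) w := fun w => by
      rw [← grayMap_apply_fst B q v w, hsol]; simp [rhs]
    rw [grayMap_apply] at hsol
    have hX : v.1 ∈ D q := (hBq.mem_iff hq1 v.1).2 (congrArg (fun a => a.2.1) hsol)
    have ho : ⟪q.2, v.1⟫ = 0 := congrArg (fun a => a.2.2) hsol
    have hm : v.2.2 = 0 := by
      have := h1 q.2
      rw [hD.fderiv_apply_radial hBq hq1 hq2 hX, hD.fderiv_radial_apply hBq hq1 hq2 hX,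
        (hBq.mem_iff hq1 _).1 (hD.radial q.1 hq1 q.2 hq2),
        hD.fderiv_apply_radial hBq hq1 hq2 (zero_mem _)] at this
      simpa [hq2] using this
    refine hD.isGrayVector_of_form hBq hq1 hq2 hX ho fun w hw => ?_
    have h2 := h1 w
    rw [hm, (hBq.mem_iff hq1 w).1 hw] at h2
    have h3 : ((1 : ℝ), v.1) = (1, 0) + (0, v.1) := by simp
    rw [h3, map_add, _root_.add_apply]
    linarith

end LinearSystem

/-! ### Gluing Gray vectors into a global vector field. -/

variable [FiniteDimensional ℝ E]

/-- A global time-dependent vector field, tangent to the spheres, which consists of Gray vectors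
near the unit sphere for the times in `[0,1]`. -/
lemma IsConicContact.exists_vectorField (hD : IsConicContact D) :
    ∃ Y : ℝ × E → E, ContDiff ℝ ∞ Y ∧ HasCompactSupport Y ∧ (∀ q, ⟪q.2, Y q⟫ = 0) ∧
      ∀ q : ℝ × E, q.1 ∈ Icc (0 : ℝ) 1 → ‖q.2‖ ∈ Icc (1 / 2 : ℝ) 2 → IsGrayVector D q (Y q) := by
  let K : Set (ℝ × E) := {q | q.1 ∈ Icc (0 : ℝ) 1 ∧ ‖q.2‖ ∈ Icc (1 / 2 : ℝ) 2}
  have hK : IsClosed K := (isClosed_Icc.preimage continuous_fst).inter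
    (isClosed_Icc.preimage continuous_snd.norm)
  have hKn : ∀ q ∈ K, ‖q‖ < 10 := fun q hq => by
    rw [Prod.norm_def, max_lt_iff, Real.norm_eq_abs, abs_of_nonneg hq.1.1]
    constructor
    · linarith [hq.1.2]
    · linarith [hq.2.2]
  -- A partition of unity needs convex constraints. On `K` the constraint allows a single vector, by
  -- uniqueness. The radius `10` is any bound strictly beyond `K`, and forces compact support.
  let C : ℝ × E → Set E := fun q =>
    {X | ⟪q.2, X⟫ = 0 ∧ (10 ≤ ‖q‖ → X = 0) ∧ (q ∈ K → IsGrayVector D q X)}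
  have hconv : ∀ q, Convex ℝ (C q) := by
    rintro q X ⟨h1, h2, h3⟩ Z ⟨k1, k2, k3⟩ a b _ _ hab
    refine ⟨?_, ?_, ?_⟩
    · rw [inner_add_right, inner_smul_right, inner_smul_right, h1, k1]; simp
    · intro hq; rw [h2 hq, k2 hq]; simp
    · intro hq
      have hq0 : q.2 ≠ 0 := fun h0 => by
        have := hq.2.1
        rw [h0, norm_zero] at this
        linarith
      rw [← hD.eq_of_isGrayVector hq.1 hq0 (h3 hq) (k3 hq), ← add_smul, hab, one_smul]
      exact h3 hq
  obtain ⟨Y, hY⟩ := exists_contMDiffMap_forall_mem_convex_of_local (n := ⊤) 𝓘(ℝ, ℝ × E) hconv (by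
    intro q
    by_cases hq : q ∈ K
    · have hq0 : q.2 ≠ 0 := fun h0 => by
        have := hq.2.1
        rw [h0, norm_zero] at this
        linarith
      obtain ⟨g, hg, hg'⟩ := hD.exists_local_gray (p := q) hq.1 hq0
      refine ⟨_, (hg.and (hg'.and (continuous_norm.continuousAt.eventually_lt
        continuousAt_const (hKn q hq)))), g, fun z hz => ?_, fun z hz => ?_⟩
      · exact hz.1.1.contMDiffAt.contMDiffWithinAt
      · exact ⟨hz.1.2, fun h => absurd hz.2.2 (not_lt.2 h), fun h => hz.2.1 h.1⟩
    · refine ⟨Kᶜ, hK.isOpen_compl.mem_nhds hq, 0, contMDiffOn_const, fun z hz => ?_⟩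
      exact ⟨by simp, fun _ => rfl, fun h => absurd h hz⟩)
  refine ⟨Y, contMDiff_iff_contDiff.1 Y.contMDiff, ?_, fun q => (hY q).1,
    fun q h1 h2 => (hY q).2.2 ⟨h1, h2⟩⟩
  refine HasCompactSupport.intro (isCompact_closedBall 0 10) fun q hq => (hY q).2.1 ?_
  rw [Metric.mem_closedBall, dist_zero_right, not_le] at hq
  exact hq.le

end ConicGray

/-! ### Behaviour of Gray vectors under symmetries. -/

namespace ConicGray

open Set Filter
open scoped Topology RealInnerProductSpace

variable {E : Type u} [NormedAddCommGroup E] [InnerProductSpace ℝ E] {D : ℝ × E → Submodule ℝ E}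
  {p : ℝ × E}

lemma two_le_smooth : minSmoothness ℝ 2 ≤ (∞ : ℕ∞ω) := by
  rw [minSmoothness_of_isRCLikeNormedField]
  exact WithTop.coe_le_coe.2 le_top

/-- An involution of `E \ 0` that preserves the norm and the distribution. -/
structure IsSymmetry (D : ℝ × E → Submodule ℝ E) (U : E → E) : Prop where
  smooth : ∀ y ≠ 0, ContDiffAt ℝ ∞ U y
  involutive : ∀ y ≠ 0, U (U y) = y
  norm_eq : ∀ y ≠ 0, ‖U y‖ = ‖y‖
  mem_iff : ∀ t ∈ Icc (0 : ℝ) 1, ∀ y ≠ 0, ∀ w, w ∈ D (t, y) ↔ fderiv ℝ U y w ∈ D (t, U y)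

namespace IsSymmetry

variable {U : E → E}

lemma ne_zero (hU : IsSymmetry D U) {y : E} (hy : y ≠ 0) : U y ≠ 0 := by
  rw [← norm_ne_zero_iff, hU.norm_eq y hy]
  exact norm_ne_zero_iff.2 hy

lemma hasFDerivAt (hU : IsSymmetry D U) {y : E} (hy : y ≠ 0) : HasFDerivAt U (fderiv ℝ U y) y :=
  ((hU.smooth y hy).differentiableAt (by simp)).hasFDerivAt

lemma fderiv_fderiv (hU : IsSymmetry D U) {y : E} (hy : y ≠ 0) (w : E) :
    fderiv ℝ U y (fderiv ℝ U (U y) w) = w := by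
  have h1 : HasFDerivAt U (fderiv ℝ U y) (U (U y)) := by
    rw [hU.involutive y hy]; exact hU.hasFDerivAt hy
  have h2 := h1.comp (U y) (hU.hasFDerivAt (hU.ne_zero hy))
  have h3 : U ∘ U =ᶠ[𝓝 (U y)] id := by
    filter_upwards [eventually_ne_nhds (hU.ne_zero hy)] with z hz using hU.involutive z hz
  have h4 := (h2.congr_of_eventuallyEq h3.symm).unique (hasFDerivAt_id _)
  exact congrArg (fun L : E →L[ℝ] E => L w) h4

/-- Differentiate `‖U z‖ ^ 2 = ‖z‖ ^ 2`; this is what carries the orthogonality normalisation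
through `U`. -/
lemma inner_fderiv (hU : IsSymmetry D U) {y : E} (hy : y ≠ 0) (w : E) :
    ⟪U y, fderiv ℝ U y w⟫ = ⟪y, w⟫ := by
  have h1 := (hU.hasFDerivAt hy).norm_sq
  have h2 := (hasFDerivAt_id (𝕜 := ℝ) y).norm_sq
  have h3 : (fun z => ‖U z‖ ^ 2) =ᶠ[𝓝 y] fun z => ‖id z‖ ^ 2 := by
    filter_upwards [eventually_ne_nhds hy] with z hz
    rw [hU.norm_eq z hz, id]
  have h4 := congrArg (fun L : E →L[ℝ] ℝ => L w) (h1.unique (h2.congr_of_eventuallyEq h3))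
  simpa using h4

lemma tendsto (hU : IsSymmetry D U) (hp2 : p.2 ≠ 0) :
    Tendsto (fun q : ℝ × E => (q.1, U q.2)) (𝓝 p) (𝓝 (p.1, U p.2)) :=
  continuousAt_fst.prodMk (((hU.smooth p.2 hp2).continuousAt).comp continuousAt_snd)

lemma isDefiningForm_pullback (hU : IsSymmetry D U) (hp2 : p.2 ≠ 0)
    {B : ℝ × E → E →L[ℝ] ℝ} (hB : IsDefiningForm D (p.1, U p.2) B) :
    IsDefiningForm D p (fun q => (B (q.1, U q.2)).comp (fderiv ℝ U q.2)) := by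
  have hne : ∀ᶠ q : ℝ × E in 𝓝 p, q.2 ≠ 0 := continuousAt_snd.eventually_ne hp2
  refine ⟨?_, ?_⟩
  · filter_upwards [(hU.tendsto hp2).eventually hB.smooth, hne] with q h1 h2
    have h3 : ContDiffAt ℝ ∞ (fun q : ℝ × E => U q.2) q :=
      (hU.smooth q.2 h2).comp q contDiffAt_snd
    have h4 : ContDiffAt ℝ ∞ (fun q : ℝ × E => fderiv ℝ U q.2) q :=
      ((hU.smooth q.2 h2).fderiv_right (m := ∞) (by simp)).comp q contDiffAt_snd
    exact (h1.comp q (contDiffAt_fst.prodMk h3)).clm_comp h4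
  · filter_upwards [(hU.tendsto hp2).eventually hB.ker, hne] with q h1 h2 h3 w
    rw [hU.mem_iff q.1 h3 q.2 h2 w, h1 h3]
    rfl

lemma fderiv_pullback (hU : IsSymmetry D U) (hp2 : p.2 ≠ 0)
    {B : ℝ × E → E →L[ℝ] ℝ} (hB : IsDefiningForm D (p.1, U p.2) B) (τ : ℝ) (v w : E) :
    fderiv ℝ (fun q : ℝ × E => (B (q.1, U q.2)).comp (fderiv ℝ U q.2)) p (τ, v) w =
      fderiv ℝ B (p.1, U p.2) (τ, fderiv ℝ U p.2 v) (fderiv ℝ U p.2 w) +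
        B (p.1, U p.2) (fderiv ℝ (fderiv ℝ U) p.2 v w) := by
  have h1 : HasFDerivAt (fun q : ℝ × E => (q.1, U q.2))
      ((ContinuousLinearMap.fst ℝ ℝ E).prod ((fderiv ℝ U p.2).comp (.snd ℝ ℝ E))) p :=
    hasFDerivAt_fst.prodMk ((hU.hasFDerivAt hp2).comp p hasFDerivAt_snd)
  have h2 := HasFDerivAt.comp p (g := B) (f := fun q : ℝ × E => (q.1, U q.2))
    hB.differentiableAt.hasFDerivAt h1
  have h3 : HasFDerivAt (fun q : ℝ × E => fderiv ℝ U q.2)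
      ((fderiv ℝ (fderiv ℝ U) p.2).comp (.snd ℝ ℝ E)) p :=
    (((hU.smooth p.2 hp2).fderiv_right (m := ∞) (by simp)).differentiableAt
      (by simp)).hasFDerivAt.comp p hasFDerivAt_snd
  have h4 := h2.clm_comp h3
  have h5 := h4.fderiv
  simp only [Function.comp_apply] at h5
  rw [h5]
  simp [add_comm]

/-- Defining forms at the image point pull back to defining forms at `p`. The second derivative of
`U` enters both sides of the Gray equation and cancels by symmetry, as in `d(U^*B) = U^*dB`. -/
lemma isGrayVector (hU : IsSymmetry D U) (hp : p.1 ∈ Icc (0 : ℝ) 1) (hp2 : p.2 ≠ 0) {X : E}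
    (hX : IsGrayVector D p X) : IsGrayVector D (p.1, U p.2) (fderiv ℝ U p.2 X) := by
  refine ⟨(hU.mem_iff p.1 hp p.2 hp2 X).1 hX.mem, ?_, fun B hB w hw => ?_⟩
  · exact (hU.inner_fderiv hp2 X).trans hX.orth
  · set w' := fderiv ℝ U (U p.2) w with hw'
    have hww : fderiv ℝ U p.2 w' = w := hU.fderiv_fderiv hp2 w
    have hwD : w' ∈ D p := (hU.mem_iff p.1 hp p.2 hp2 w').2 (by rw [hww]; exact hw)
    have h1 := hX.eq _ (hU.isDefiningForm_pullback hp2 hB) w' hwD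
    rw [hU.fderiv_pullback hp2 hB, hU.fderiv_pullback hp2 hB, hww] at h1
    have hs : IsSymmSndFDerivAt ℝ U p.2 :=
      (hU.smooth p.2 hp2).isSymmSndFDerivAt two_le_smooth
    rw [hs.eq X w'] at h1
    exact add_right_cancel h1

end IsSymmetry

end ConicGray

/-! ### The isotopy generated by Gray vectors. -/

namespace ConicGray

open Set Filter
open scoped Topology RealInnerProductSpace

variable {E : Type u} [NormedAddCommGroup E] [InnerProductSpace ℝ E] {D : ℝ × E → Submodule ℝ E}
  {p : ℝ × E}

/-- The smooth flow of a compactly supported time-dependent vector field. -/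
lemma exists_timeDependent_flow [CompleteSpace E] {Y : ℝ × E → E} (hY : ContDiff ℝ ∞ Y)
    {K : NNReal} (hK : LipschitzWith K Y) (hYs : HasCompactSupport Y) :
    ∃ Ψ Ψinv : ℝ → E → E, ContDiff ℝ ∞ (fun q : ℝ × E => Ψ q.1 q.2) ∧
      (∀ t, ContDiff ℝ ∞ (Ψinv t)) ∧ (∀ t x, Ψinv t (Ψ t x) = x) ∧
      (∀ t x, Ψ t (Ψinv t x) = x) ∧ (∀ x, Ψ 0 x = x) ∧
      ∀ x t, HasDerivAt (Ψ · x) (Y (t, Ψ t x)) t := by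
  -- Adding time as a coordinate makes the equation autonomous; flowing backwards by `t` from `(t,
  -- x)` gives the inverse of the time-`t` map.
  let f : ℝ × E → ℝ × E := fun q => (1, Y q)
  have hf : ContDiff ℝ ∞ f := contDiff_const.prodMk hY
  have hfK : LipschitzWith (max 0 K) f := (LipschitzWith.const (1 : ℝ)).prodMk hK
  obtain ⟨C, hC⟩ := hYs.exists_bound_of_continuous hY.continuous
  have hfC : ∀ q, ‖f q‖ ≤ (max 1 C).toNNReal := fun q => by
    rw [Real.coe_toNNReal _ (le_max_of_le_left zero_le_one), Prod.norm_def, norm_one]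
    exact max_le_max le_rfl (hC q)
  obtain ⟨φ, h0, hφ, hg, hs⟩ := SmoothFlow.exists_smooth_flow hf hfK hfC
  have hfst : ∀ t q, (φ t q).1 = q.1 + t := by
    intro t q
    have h1 : ∀ s, HasDerivAt (fun s => (φ s q).1 - s) 0 s := fun s => by
      have := (hasFDerivAt_fst (𝕜 := ℝ) (p := φ s q)).comp_hasDerivAt s (hφ q s)
      simpa [f] using! this.sub (hasDerivAt_id s)
    have h2 := is_const_of_deriv_eq_zero (fun s => (h1 s).differentiableAt)
      (fun s => (h1 s).deriv) t 0
    simp only [h0, sub_zero] at h2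
    linarith
  have hpair : ∀ t x, φ t (0, x) = (t, (φ t (0, x)).2) := fun t x => by
    ext1
    · simp [hfst]
    · rfl
  have hpair' : ∀ t x, φ (-t) (t, x) = (0, (φ (-t) (t, x)).2) := fun t x => by
    ext1
    · simp [hfst]
    · rfl
  refine ⟨fun t x => (φ t (0, x)).2, fun t x => (φ (-t) (t, x)).2, ?_, fun t => ?_,
    fun t x => ?_, fun t x => ?_, fun x => ?_, fun x t => ?_⟩
  · exact contDiff_snd.comp (hs.comp (contDiff_fst.prodMk (contDiff_const.prodMk contDiff_snd)))
  · exact contDiff_snd.comp (hs.comp (contDiff_const.prodMk (contDiff_const.prodMk contDiff_id)))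
  · simp only []
    rw [← hpair, ← hg, neg_add_cancel, h0]
  · simp only []
    rw [← hpair', ← hg, add_neg_cancel, h0]
  · simp only []
    rw [h0]
  · have := (hasFDerivAt_snd (𝕜 := ℝ) (p := φ t (0, x))).comp_hasDerivAt t (hφ (0, x) t)
    rw [← hpair]
    exact this

/-- The linearization of a smooth flow solves the linearized equation. -/
lemma hasDerivAt_fderiv_flow {Y : ℝ × E → E} (hY : ContDiff ℝ ∞ Y) {Ψ : ℝ → E → E}
    (hs : ContDiff ℝ ∞ (fun q : ℝ × E => Ψ q.1 q.2))
    (hΨ : ∀ x t, HasDerivAt (Ψ · x) (Y (t, Ψ t x)) t) (x v : E) (t : ℝ) :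
    HasDerivAt (fun t => fderiv ℝ (Ψ t) x v)
      (fderiv ℝ Y (t, Ψ t x) (0, fderiv ℝ (Ψ t) x v)) t := by
  let F : ℝ × E → E := fun q => Ψ q.1 q.2
  have hF : ∀ q, HasFDerivAt F (fderiv ℝ F q) q := fun q =>
    (hs.differentiable (by simp)).differentiableAt.hasFDerivAt
  have hx : ∀ t x, HasFDerivAt (Ψ t) ((fderiv ℝ F (t, x)).comp (.inr ℝ ℝ E)) x := fun t x =>
    HasFDerivAt.comp x (hF (t, x)) (hasFDerivAt_prodMk_right t x)
  have hx' : ∀ t x v, fderiv ℝ (Ψ t) x v = fderiv ℝ F (t, x) (0, v) := fun t x v => by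
    rw [(hx t x).fderiv]; simp
  have ht : ∀ t x, fderiv ℝ F (t, x) (1, 0) = Y (t, F (t, x)) := fun t x => by
    have h1 : HasDerivAt (fun s : ℝ => (s, x)) ((1 : ℝ), (0 : E)) t :=
      (hasDerivAt_id t).prodMk (hasDerivAt_const t x)
    have h2 : HasDerivAt (fun s => Ψ s x) (fderiv ℝ F (t, x) (1, 0)) t :=
      HasFDerivAt.comp_hasDerivAt (l := F) (f := fun s => (s, x)) t (hF (t, x)) h1
    exact h2.unique (hΨ x t)
  have hd : HasFDerivAt (fderiv ℝ F) (fderiv ℝ (fderiv ℝ F) (t, x)) (t, x) :=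
    ((hs.fderiv_right (m := ∞) (by simp)).differentiable (by simp)).differentiableAt.hasFDerivAt
  have h1 : HasDerivAt (fun s : ℝ => (s, x)) ((1 : ℝ), (0 : E)) t :=
    (hasDerivAt_id t).prodMk (hasDerivAt_const t x)
  have h2 : HasDerivAt (fun s => fderiv ℝ F (s, x)) (fderiv ℝ (fderiv ℝ F) (t, x) (1, 0)) t :=
    HasFDerivAt.comp_hasDerivAt (l := fderiv ℝ F) (f := fun s => (s, x)) t hd h1
  have h2 := h2.clm_apply (hasDerivAt_const t ((0 : ℝ), v))
  have hsymm : IsSymmSndFDerivAt ℝ F (t, x) := hs.contDiffAt.isSymmSndFDerivAt two_le_smooth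
  have h3 : HasFDerivAt (fun z => fderiv ℝ F (t, z) (1, 0))
      (((fderiv ℝ (fderiv ℝ F) (t, x)).flip (1, 0)).comp (.inr ℝ ℝ E)) x := by
    have k : HasFDerivAt (fun q => fderiv ℝ F q (1, 0))
        ((fderiv ℝ (fderiv ℝ F) (t, x)).flip (1, 0)) (t, x) :=
      (hd.clm_apply (hasFDerivAt_const ((1 : ℝ), (0 : E)) (t, x))).congr_fderiv (by ext <;> simp)
    exact HasFDerivAt.comp (g := fun q => fderiv ℝ F q (1, 0)) x k (hasFDerivAt_prodMk_right t x)
  have h4 : HasFDerivAt (fun z => fderiv ℝ F (t, z) (1, 0))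
      ((fderiv ℝ Y (t, F (t, x))).comp ((ContinuousLinearMap.inr ℝ ℝ E).comp
        ((fderiv ℝ F (t, x)).comp (.inr ℝ ℝ E)))) x := by
    simp only [ht]
    have hYd : HasFDerivAt Y (fderiv ℝ Y (t, F (t, x))) (t, F (t, x)) :=
      (hY.differentiable (by simp)).differentiableAt.hasFDerivAt
    have k : HasFDerivAt (fun z => (t, F (t, z))) ((ContinuousLinearMap.inr ℝ ℝ E).comp
        ((fderiv ℝ F (t, x)).comp (.inr ℝ ℝ E))) x :=
      HasFDerivAt.comp (g := fun z => (t, z)) (f := Ψ t) x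
        (hasFDerivAt_prodMk_right t (F (t, x))) (hx t x)
    exact HasFDerivAt.comp (g := Y) (f := fun z => (t, F (t, z))) x hYd k
  have h5 := congrArg (fun L : E →L[ℝ] E => L v) (h3.unique h4)
  simp only [hx']
  refine h2.congr_deriv ?_
  simp only [ContinuousLinearMap.comp_apply, ContinuousLinearMap.flip_apply,
    ContinuousLinearMap.inr_apply] at h5
  simp only [map_zero, add_zero]
  rw [hsymm.eq]
  exact h5

/-- The function that measures whether a vector transported by the flow stays in the distribution
solves a linear differential equation. -/
lemma IsConicContact.exists_linear_ode (hD : IsConicContact D) {Y : ℝ × E → E}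
    (hY : ContDiff ℝ ∞ Y)
    (hYg : ∀ q : ℝ × E, q.1 ∈ Icc (0 : ℝ) 1 → ‖q.2‖ ∈ Icc (1 / 2 : ℝ) 2 → IsGrayVector D q (Y q))
    {c W : ℝ → E} (hc : ∀ t, HasDerivAt c (Y (t, c t)) t)
    (hW : ∀ t, HasDerivAt W (fderiv ℝ Y (t, c t) (0, W t)) t) (hn : ∀ t, ‖c t‖ = 1) {t₀ : ℝ}
    (ht₀ : t₀ ∈ Icc (0 : ℝ) 1) :
    ∃ (g g' : ℝ → ℝ) (K : ℝ), ∀ᶠ t in 𝓝 t₀, HasDerivAt g (g' t) t ∧ (t ∈ Icc (0 : ℝ) 1 →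
      (W t ∈ D (t, c t) ↔ g t = 0) ∧ |g' t| ≤ K * |g t|) := by
  have hne : ∀ t, c t ≠ 0 := fun t h => by simpa [h] using hn t
  obtain ⟨B, hB⟩ := hD.exists_form t₀ ht₀ (c t₀) (hne t₀)
  obtain ⟨e, he⟩ := hD.exists_notMem t₀ ht₀ (c t₀) (hne t₀)
  have hBe : B (t₀, c t₀) e ≠ 0 := fun h0 => he ((hB.mem_iff ht₀ e).2 h0)
  -- The Lie derivative of `B` along `∂_t + Y` is a multiple of `B` at times in `[0,1]` near the
  -- unit sphere; evaluating on the transverse vector `e` gives the factor `μ`.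
  let μ : ℝ × E → ℝ := fun q =>
    (fderiv ℝ B q (1, Y q) e - fderiv ℝ B q (0, e) (Y q)) / B q e
  have hμ : ContinuousAt μ (t₀, c t₀) := by
    have h1 : ContinuousAt B (t₀, c t₀) := hB.contDiffAt.continuousAt
    have h2 : ContinuousAt (fderiv ℝ B) (t₀, c t₀) :=
      (hB.contDiffAt.fderiv_right (m := ∞) (by simp)).continuousAt
    have h3 : ContinuousAt Y (t₀, c t₀) := hY.continuous.continuousAt
    have h4 : ContinuousAt (fun q => fderiv ℝ B q (1, Y q) e) (t₀, c t₀) :=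
      (h2.clm_apply (continuousAt_const.prodMk h3)).clm_apply continuousAt_const
    have h5 : ContinuousAt (fun q => fderiv ℝ B q (0, e) (Y q)) (t₀, c t₀) :=
      (h2.clm_apply continuousAt_const).clm_apply h3
    exact (h4.sub h5).div (h1.clm_apply continuousAt_const) hBe
  have hcc : Tendsto (fun t => (t, c t)) (𝓝 t₀) (𝓝 (t₀, c t₀)) :=
    continuousAt_id.prodMk (hc t₀).continuousAt
  refine ⟨fun t => B (t, c t) (W t), fun t => fderiv ℝ B (t, c t) (1, Y (t, c t)) (W t) +
    B (t, c t) (fderiv ℝ Y (t, c t) (0, W t)), |μ (t₀, c t₀)| + 1, ?_⟩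
  have hev1 := hcc.eventually hB.eventually
  have hev2 : ∀ᶠ t in 𝓝 t₀, B (t, c t) e ≠ 0 :=
    hcc.eventually ((hB.contDiffAt.continuousAt.clm_apply continuousAt_const).eventually_ne hBe)
  have hev3 : ∀ᶠ t in 𝓝 t₀, |μ (t, c t)| < |μ (t₀, c t₀)| + 1 :=
    hcc.eventually (hμ.abs.eventually_lt continuousAt_const (by simp))
  filter_upwards [hev1, hev2, hev3] with t h1 h2 h3
  have hdB := h1.differentiableAt.hasFDerivAt
  refine ⟨?_, fun ht => ⟨h1.mem_iff ht _, ?_⟩⟩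
  · have k1 : HasDerivAt (fun s => (s, c s)) ((1 : ℝ), Y (t, c t)) t :=
      (hasDerivAt_id t).prodMk (hc t)
    have k2 : HasDerivAt (fun s => B (s, c s)) (fderiv ℝ B (t, c t) (1, Y (t, c t))) t :=
      HasFDerivAt.comp_hasDerivAt (l := B) (f := fun s => (s, c s)) t hdB k1
    exact k2.clm_apply (hW t)
  · have hdY : HasFDerivAt Y (fderiv ℝ Y (t, c t)) (t, c t) :=
      (hY.differentiable (by simp)).differentiableAt.hasFDerivAt
    -- The identity `B(Y) = 0` is differentiated, so `Y` must be Gray on a neighbourhood of the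
    -- sphere and not only on it.
    have hYB := hasFDerivAt_eq_zero (uniqueDiffWithinAt_slab (p := (t, c t)) ht)
      ⟨ht, mem_univ _⟩ (hdB.clm_apply hdY) (by
        have hcn : ∀ᶠ q : ℝ × E in 𝓝 (t, c t), ‖q.2‖ ∈ Icc (1 / 2 : ℝ) 2 := by
          refine (continuous_snd.norm.continuousAt (x := (t, c t))).eventually
            (Icc_mem_nhds ?_ ?_) <;> norm_num [hn]
        filter_upwards [mem_nhdsWithin_of_mem_nhds h1.ker, mem_nhdsWithin_of_mem_nhds hcn,
          self_mem_nhdsWithin] with q k1 k2 k3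
        exact (k1 k3.1 _).1 (hYg q k3.1 k2).mem)
    have hYB' := congrArg (fun L : ℝ × E →L[ℝ] ℝ => L (0, W t)) hYB
    simp only [_root_.add_apply, ContinuousLinearMap.comp_apply,
      ContinuousLinearMap.flip_apply, _root_.zero_apply] at hYB'
    have hG := hYg (t, c t) ht (by rw [hn]; norm_num)
    -- This is `W t` corrected along `e` to lie in `D`. The Gray equation on it, plus `B e` times
    -- the differentiated identity `B(Y) = 0`, gives `g' = μ g`.
    have hmem : B (t, c t) e • W t - B (t, c t) (W t) • e ∈ D (t, c t) :=
      (h1.mem_iff ht _).2 (by simp [mul_comm])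
    have h4 := hG.eq B h1 _ hmem
    have h5 : ((0 : ℝ), B (t, c t) e • W t - B (t, c t) (W t) • e) =
        B (t, c t) e • (0, W t) - B (t, c t) (W t) • (0, e) := by simp
    rw [h5] at h4
    simp only [map_sub, map_smul, smul_eq_mul, _root_.sub_apply, _root_.smul_apply] at h4
    have h6 : fderiv ℝ B (t, c t) (1, Y (t, c t)) (W t) +
        B (t, c t) (fderiv ℝ Y (t, c t) (0, W t)) = μ (t, c t) * B (t, c t) (W t) := by
      simp only [μ]
      field_simp
      linear_combination h4 + B (t, c t) e * hYB'
    rw [h6, abs_mul]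
    exact mul_le_mul_of_nonneg_right h3.le (abs_nonneg _)

/-- The flow of Gray vectors preserves the family of distributions. -/
lemma IsConicContact.mem_of_flow (hD : IsConicContact D) {Y : ℝ × E → E}
    (hY : ContDiff ℝ ∞ Y)
    (hYg : ∀ q : ℝ × E, q.1 ∈ Icc (0 : ℝ) 1 → ‖q.2‖ ∈ Icc (1 / 2 : ℝ) 2 → IsGrayVector D q (Y q))
    {c W : ℝ → E} (hc : ∀ t, HasDerivAt c (Y (t, c t)) t)
    (hW : ∀ t, HasDerivAt W (fderiv ℝ Y (t, c t) (0, W t)) t) (hn : ∀ t, ‖c t‖ = 1)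
    (h0 : W 0 ∈ D (0, c 0)) : ∀ t ∈ Icc (0 : ℝ) 1, W t ∈ D (t, c t) := by
  let T : Set ℝ := {t | W t ∈ D (t, c t)}
  change Icc (0 : ℝ) 1 ⊆ T
  -- Defining forms are local in time, so the argument is a continuous induction: closedness by
  -- continuity of `g`, and progress to the right from `|g'| ≤ K |g|` with `g t = 0`.
  refine IsClosed.Icc_subset_of_forall_exists_gt ?_ h0 ?_
  · refine isClosed_of_closure_subset fun t ht => ?_
    have htI : t ∈ Icc (0 : ℝ) 1 :=
      closure_minimal inter_subset_right isClosed_Icc ht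
    obtain ⟨g, g', K, hg⟩ := hD.exists_linear_ode hY hYg hc hW hn htI
    have hgc : ContinuousAt g t := hg.self_of_nhds.1.continuousAt
    refine ⟨((hg.self_of_nhds.2 htI).1).2 ?_, htI⟩
    by_contra hne
    have h1 := (mem_closure_iff_frequently.1 ht).and_eventually (hg.and (hgc.eventually_ne hne))
    obtain ⟨s, hs, hs1, hs2⟩ := h1.exists
    exact hs2 (((hs1.2 hs.2).1).1 hs.1)
  · rintro t ⟨htT, ht⟩ y hy
    have htI := Ico_subset_Icc_self ht
    obtain ⟨g, g', K, hg⟩ := hD.exists_linear_ode hY hYg hc hW hn htI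
    obtain ⟨δ, hδ, hball⟩ := Metric.eventually_nhds_iff_ball.1 hg
    let b := min (min y 1) (t + δ / 2)
    have htb : t < b := lt_min (lt_min hy ht.2) (by linarith)
    have hb1 : b ≤ 1 := (min_le_left _ _).trans (min_le_right _ _)
    have hbd : ∀ s ∈ Icc t b, s ∈ Metric.ball t δ := fun s hs => by
      rw [Metric.mem_ball, Real.dist_eq, abs_of_nonneg (by linarith [hs.1])]
      have : b ≤ t + δ / 2 := min_le_right _ _
      linarith [hs.2]
    have hsI : ∀ s ∈ Icc t b, s ∈ Icc (0 : ℝ) 1 := fun s hs =>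
      ⟨ht.1.trans hs.1, hs.2.trans hb1⟩
    have hz := eq_zero_of_abs_deriv_le_mul_abs_self_of_eq_zero_right (f := g) (f' := g') (K := K)
      (a := t) (b := b)
      (fun s hs => (hball s (hbd s hs)).1.continuousAt.continuousWithinAt)
      (fun s hs => (hball s (hbd s (Ico_subset_Icc_self hs))).1.hasDerivWithinAt)
      (((hball t (hbd t ⟨le_rfl, htb.le⟩)).2 htI).1.1 htT)
      (fun s hs => ((hball s (hbd s (Ico_subset_Icc_self hs))).2
        (hsI s (Ico_subset_Icc_self hs))).2)
    have hbm : b ∈ Icc t b := ⟨htb.le, le_rfl⟩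
    exact ⟨b, ((hball b (hbd b hbm)).2 (hsI b hbm)).1.2 (hz b hbm), htb,
      (min_le_left _ _).trans (min_le_left _ _)⟩

/-- **Gray stability** for conic contact distributions, equivariant under symmetries. -/
theorem IsConicContact.exists_isotopy [FiniteDimensional ℝ E] (hD : IsConicContact D) :
    ∃ Ψ Ψinv : ℝ → E → E, ContDiff ℝ ∞ (fun q : ℝ × E => Ψ q.1 q.2) ∧
      (∀ t, ContDiff ℝ ∞ (Ψinv t)) ∧ (∀ t x, Ψinv t (Ψ t x) = x) ∧
      (∀ t x, Ψ t (Ψinv t x) = x) ∧ (∀ x, Ψ 0 x = x) ∧ (∀ t x, ‖Ψ t x‖ = ‖x‖) ∧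
      (∀ x, ‖x‖ = 1 → ∀ v ∈ D (0, x), ∀ t ∈ Icc (0 : ℝ) 1,
        fderiv ℝ (Ψ t) x v ∈ D (t, Ψ t x)) ∧
      ∀ U, IsSymmetry D U → ∀ x, ‖x‖ = 1 → ∀ t ∈ Icc (0 : ℝ) 1, Ψ t (U x) = U (Ψ t x) := by
  obtain ⟨Y, hY, hYs, hYo, hYg⟩ := hD.exists_vectorField
  obtain ⟨K, hK⟩ := ContDiff.lipschitzWith_of_hasCompactSupport hYs hY (by simp)
  obtain ⟨Ψ, Ψinv, hs, hsi, hl, hr, h0, hΨ⟩ := exists_timeDependent_flow hY hK hYs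
  have hnorm : ∀ t x, ‖Ψ t x‖ = ‖x‖ := by
    intro t x
    have h1 : ∀ s, HasDerivAt (fun s => ‖Ψ s x‖ ^ 2) 0 s := fun s => by
      have := (hΨ x s).norm_sq
      rwa [hYo (s, Ψ s x), mul_zero] at this
    have h2 := is_const_of_deriv_eq_zero (fun s => (h1 s).differentiableAt)
      (fun s => (h1 s).deriv) t 0
    simp only [h0] at h2
    exact (pow_left_inj₀ (norm_nonneg _) (norm_nonneg _) two_ne_zero).1 h2
  refine ⟨Ψ, Ψinv, hs, hsi, hl, hr, h0, hnorm, ?_, ?_⟩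
  · intro x hx v hv
    refine hD.mem_of_flow hY hYg (hΨ x) (hasDerivAt_fderiv_flow hY hs hΨ x v)
      (fun t => (hnorm t x).trans hx) ?_
    have : Ψ 0 = id := funext h0
    rw [this]
    simpa using hv
  · intro U hU x hx
    have hx0 : x ≠ 0 := fun h => by simp [h] at hx
    have hne : ∀ t, Ψ t x ≠ 0 := fun t => by
      rw [← norm_ne_zero_iff, hnorm, hx]; exact one_ne_zero
    have hUd : ∀ t, HasDerivAt (fun t => U (Ψ t x)) (fderiv ℝ U (Ψ t x) (Y (t, Ψ t x))) t :=
      fun t => (hU.hasFDerivAt (hne t)).comp_hasDerivAt t (hΨ x t)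
    -- The vector field is invariant under `U` because `U` sends Gray vectors to Gray vectors and
    -- these are unique. Hence `Ψ t (U x)` and `U (Ψ t x)` solve the same equation.
    have hUY : ∀ t ∈ Icc (0 : ℝ) 1,
        fderiv ℝ U (Ψ t x) (Y (t, Ψ t x)) = Y (t, U (Ψ t x)) := fun t ht =>
      hD.eq_of_isGrayVector (p := (t, U (Ψ t x))) ht (hU.ne_zero (hne t))
        (hU.isGrayVector (p := (t, Ψ t x)) ht (hne t)
          (hYg _ ht (by rw [hnorm, hx]; norm_num)))
        (hYg _ ht (by rw [hU.norm_eq _ (hne t), hnorm, hx]; norm_num))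
    refine ODE_solution_unique (v := fun t z => Y (t, z)) (K := K * 1)
      (f := fun t => Ψ t (U x)) (g := fun t => U (Ψ t x))
      (fun t => hK.comp (LipschitzWith.prodMk_left t))
      (fun t _ => (hΨ (U x) t).continuousAt.continuousWithinAt)
      (fun t _ => (hΨ (U x) t).hasDerivWithinAt)
      (fun t _ => (hUd t).continuousAt.continuousWithinAt)
      (fun t ht => ?_) (by simp only [h0])
    rw [← hUY t (Ico_subset_Icc_self ht)]
    exact (hUd t).hasDerivWithinAt

end ConicGray

/-! ### The radial projection onto the sphere and pullbacks of forms. -/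

namespace InvContact

open Set Filter
open scoped Topology RealInnerProductSpace

abbrev E4 : Type := EuclideanSpace ℝ (Fin 4)

lemma fact_finrank : Fact (Module.finrank ℝ (EuclideanSpace ℝ (Fin 4)) = 3 + 1) :=
  ⟨finrank_euclideanSpace_fin⟩

lemma contMDiff_coe : ContMDiff (𝓡 3) 𝓘(ℝ, E4) ∞ (fun y : S3 => (y : E4)) :=
  haveI := fact_finrank
  contMDiff_coe_sphere

lemma range_dIncl (x : S3) : (dIncl x).range = (ℝ ∙ (x : E4))ᗮ :=
  haveI := fact_finrank
  range_mvfderiv_subtypeVal (n := 3) x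

lemma dIncl_injective (x : S3) : Function.Injective (dIncl x) :=
  haveI := fact_finrank
  injective_mvfderiv_subtypeVal_sphere (n := 3) x

lemma contMDiff_codRestrict {F H M : Type*} [NormedAddCommGroup F] [NormedSpace ℝ F]
    [TopologicalSpace H] {I : ModelWithCorners ℝ F H} [TopologicalSpace M] [ChartedSpace H M]
    [IsManifold I ∞ M] {f : M → E4} (hf : ContMDiff I 𝓘(ℝ, E4) ∞ f)
    (hf' : ∀ x, f x ∈ Metric.sphere (0 : E4) 1) :
    ContMDiff I (𝓡 3) ∞ (Set.codRestrict f _ hf' : M → S3) :=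
  haveI := fact_finrank
  hf.codRestrict_sphere (n := 3) hf'

/-- The radial projection `ℝ⁴ ∖ 0 → S³`. -/
noncomputable def proj (y : E4) : S3 :=
  if h : y = 0 then ⟨EuclideanSpace.single 0 1, by simp⟩
  else ⟨‖y‖⁻¹ • y, by simp [norm_smul, h]⟩

lemma coe_proj {y : E4} (hy : y ≠ 0) : (proj y : E4) = ‖y‖⁻¹ • y := by
  simp [proj, hy]

lemma coe_ne_zero (x : S3) : (x : E4) ≠ 0 := ne_zero_of_mem_unit_sphere x

lemma norm_smul_proj {y : E4} (hy : y ≠ 0) : ‖y‖ • (proj y : E4) = y := by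
  rw [coe_proj hy, smul_inv_smul₀ (norm_ne_zero_iff.2 hy)]

@[simp] lemma proj_coe (x : S3) : proj (x : E4) = x := by
  ext1
  rw [coe_proj (coe_ne_zero x)]
  simp

lemma coe_proj_of_norm_eq_one {y : E4} (hy : ‖y‖ = 1) : (proj y : E4) = y := by
  have : y ≠ 0 := fun h => by simp [h] at hy
  rw [coe_proj this, hy, inv_one, one_smul]

lemma proj_smul {c : ℝ} (hc : 0 < c) (y : E4) : proj (c • y) = proj y := by
  by_cases hy : y = 0
  · simp [hy]
  · ext1
    rw [coe_proj hy, coe_proj (smul_ne_zero hc.ne' hy), norm_smul, smul_smul, Real.norm_eq_abs,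
      abs_of_pos hc]
    congr 1
    field_simp

lemma contDiffAt_normalize {y : E4} (hy : y ≠ 0) :
    ContDiffAt ℝ ∞ (fun y : E4 => ‖y‖⁻¹ • y) y :=
  ((contDiffAt_norm ℝ hy).inv (norm_ne_zero_iff.2 hy)).smul contDiffAt_id

lemma contMDiffAt_proj {y : E4} (hy : y ≠ 0) : ContMDiffAt 𝓘(ℝ, E4) (𝓡 3) ∞ proj y := by
  let O : TopologicalSpace.Opens E4 := ⟨{0}ᶜ, isOpen_compl_singleton⟩
  have h1 : ContMDiff 𝓘(ℝ, E4) 𝓘(ℝ, E4) ∞ (fun z : O => ‖(z : E4)‖⁻¹ • (z : E4)) := fun z =>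
    (contDiffAt_normalize z.2).contMDiffAt.comp z contMDiff_subtype_val.contMDiffAt
  have h2 := contMDiff_codRestrict h1 fun z => by
    have : (z : E4) ≠ 0 := z.2
    simp [norm_smul, this]
  have h3 : ContMDiffAt 𝓘(ℝ, E4) (𝓡 3) ∞ (fun z : O => proj z) ⟨y, hy⟩ := by
    refine (h2 ⟨y, hy⟩).congr_of_eventuallyEq (Eventually.of_forall fun z => ?_)
    ext1
    exact coe_proj z.2
  exact contMDiffAt_subtype_iff.1 h3

lemma mdifferentiableAt_proj {y : E4} (hy : y ≠ 0) : MDifferentiableAt 𝓘(ℝ, E4) (𝓡 3) proj y :=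
  (contMDiffAt_proj hy).mdifferentiableAt (by simp)

lemma mdifferentiableAt_coe (x : S3) :
    MDifferentiableAt (𝓡 3) 𝓘(ℝ, E4) (fun y : S3 => (y : E4)) x :=
  contMDiff_coe.mdifferentiableAt (by simp)

/-- The differential of the radial projection. -/
lemma dIncl_mfderiv_proj {y : E4} (hy : y ≠ 0) (X : E4) :
    dIncl (proj y) (mfderiv 𝓘(ℝ, E4) (𝓡 3) proj y X) =
      ‖y‖⁻¹ • X - ((‖y‖⁻¹) ^ 3 * ⟪y, X⟫) • y := by
  have hn : ‖y‖ ≠ 0 := norm_ne_zero_iff.2 hy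
  have h1 : mfderiv 𝓘(ℝ, E4) 𝓘(ℝ, E4) ((fun z : S3 => (z : E4)) ∘ proj) y X =
      dIncl (proj y) (mfderiv 𝓘(ℝ, E4) (𝓡 3) proj y X) :=
    mfderiv_comp_apply y (mdifferentiableAt_coe _) (mdifferentiableAt_proj hy) X
  rw [← h1, mfderiv_eq_fderiv]
  have h2 : ((fun z : S3 => (z : E4)) ∘ proj) =ᶠ[𝓝 y] fun y => ‖y‖⁻¹ • y := by
    filter_upwards [eventually_ne_nhds hy] with z hz using coe_proj hz
  rw [h2.fderiv_eq]
  have h3 : HasFDerivAt (fun z : E4 => ‖z‖) (‖y‖⁻¹ • innerSL ℝ y) y := by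
    have := ((hasFDerivAt_id (𝕜 := ℝ) y).norm_sq).sqrt (by simpa using hn)
    simp only [id, Real.sqrt_sq (norm_nonneg _)] at this
    refine this.congr_fderiv ?_
    ext w
    simp
    field_simp
  have h4 : HasFDerivAt (fun z : E4 => ‖z‖⁻¹) (-((‖y‖⁻¹) ^ 3) • innerSL ℝ y) y := by
    have := (hasDerivAt_inv hn).comp_hasFDerivAt y h3
    refine this.congr_fderiv ?_
    ext w
    simp
    field_simp
  have h5 := (h4.smul (hasFDerivAt_id y)).fderiv
  have h6 : fderiv ℝ (fun y : E4 => ‖y‖⁻¹ • y) y X = _ :=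
    congrArg (fun L : E4 →L[ℝ] E4 => L X) h5
  refine h6.trans ?_
  simp [sub_eq_add_neg]

lemma inner_dIncl (x : S3) (v : TS x) : ⟪(x : E4), dIncl x v⟫ = 0 := by
  have h1 : dIncl x v ∈ (ℝ ∙ (x : E4))ᗮ := by
    rw [← range_dIncl x]
    exact ⟨v, rfl⟩
  exact Submodule.mem_orthogonal_singleton_iff_inner_right.1 h1

lemma mfderiv_proj_radial {y : E4} (hy : y ≠ 0) : mfderiv 𝓘(ℝ, E4) (𝓡 3) proj y y = 0 := by
  refine dIncl_injective _ ?_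
  have hn : ‖y‖ ≠ 0 := norm_ne_zero_iff.2 hy
  have h2 : (‖y‖⁻¹) ^ 3 * ‖y‖ ^ 2 = ‖y‖⁻¹ := by field_simp
  rw [dIncl_mfderiv_proj hy y, real_inner_self_eq_norm_sq, h2, sub_self, map_zero]

lemma mfderiv_proj_surjective {y : E4} (hy : y ≠ 0) (v : TS (proj y)) :
    ∃ X : E4, mfderiv 𝓘(ℝ, E4) (𝓡 3) proj y X = v := by
  have hn : ‖y‖ ≠ 0 := norm_ne_zero_iff.2 hy
  refine ⟨‖y‖ • dIncl (proj y) v, dIncl_injective _ ?_⟩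
  have h1 : ⟪y, dIncl (proj y) v⟫ = 0 := by
    rw [← norm_smul_proj hy, real_inner_smul_left, norm_smul_proj hy, inner_dIncl, mul_zero]
  refine (dIncl_mfderiv_proj hy _).trans ?_
  rw [inner_smul_right, h1, inv_smul_smul₀ hn]
  simp

/-- The kernel of the differential of `proj` is the radial line, so it meets the orthogonal
complement of `y` trivially. -/
lemma eq_zero_of_mfderiv_proj {y : E4} (hy : y ≠ 0) {X : E4} (ho : ⟪y, X⟫ = 0)
    (h : mfderiv 𝓘(ℝ, E4) (𝓡 3) proj y X = 0) : X = 0 := by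
  have h1 := dIncl_mfderiv_proj hy X
  rw [h, map_zero, ho, mul_zero, zero_smul, sub_zero] at h1
  exact (smul_eq_zero.1 h1.symm).resolve_left (inv_ne_zero (norm_ne_zero_iff.2 hy))

section Pull

variable {V : Type*} [NormedAddCommGroup V] [NormedSpace ℝ V]

/-- The pullback of a `1`-form on `S³` to a vector space. -/
noncomputable def OneForm.pull (γ : OneForm) (h : V → S3) (y : V) : V →L[ℝ] ℝ :=
  (γ (h y)).comp (mfderiv 𝓘(ℝ, V) (𝓡 3) h y)

lemma OneForm.pull_congr (γ : OneForm) {h h' : V → S3} {y : V} (hh : h =ᶠ[𝓝 y] h') :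
    γ.pull h y = γ.pull h' y := by
  let γ' : S3 → EuclideanSpace ℝ (Fin 3) →L[ℝ] ℝ := γ
  have h1 : (mfderiv 𝓘(ℝ, V) (𝓡 3) h y : V →L[ℝ] EuclideanSpace ℝ (Fin 3)) =
      mfderiv 𝓘(ℝ, V) (𝓡 3) h' y := hh.mfderiv_eq
  change (γ' (h y)).comp (mfderiv 𝓘(ℝ, V) (𝓡 3) h y : V →L[ℝ] EuclideanSpace ℝ (Fin 3)) =
    (γ' (h' y)).comp (mfderiv 𝓘(ℝ, V) (𝓡 3) h' y : V →L[ℝ] EuclideanSpace ℝ (Fin 3))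
  rw [h1, hh.self_of_nhds]

lemma OneForm.pull_comp {V' : Type*} [NormedAddCommGroup V'] [NormedSpace ℝ V'] (γ : OneForm)
    {h : V' → S3} {f : V → V'} {y : V} (hh : MDifferentiableAt 𝓘(ℝ, V') (𝓡 3) h (f y))
    (hf : DifferentiableAt ℝ f y) :
    γ.pull (h ∘ f) y = (γ.pull h (f y)).comp (fderiv ℝ f y) := by
  ext w
  have := mfderiv_comp_apply y hh hf.mdifferentiableAt w
  rw [mfderiv_eq_fderiv] at this
  exact congrArg (γ (h (f y))) this

/-- In finite dimension it suffices to evaluate on each fixed `w`; this composes the form, as a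
function on the tangent bundle, with the tangent map of `h` applied to the constant field `w`. -/
lemma OneForm.contDiffAt_pull {β : ℝ → OneForm} {U : Set (ℝ × S3)} (hU : IsOpen U)
    (hβ : ContMDiffOn (𝓘(ℝ, ℝ).prod (𝓡 3).tangent) 𝓘(ℝ, ℝ) ∞
        (fun p : ℝ × TangentBundle (𝓡 3) S3 => β p.1 p.2.1 p.2.2) {p | (p.1, p.2.1) ∈ U})
    [FiniteDimensional ℝ V] {h : V → S3} {s : Set V} (hs : IsOpen s)
    (hh : ContMDiffOn 𝓘(ℝ, V) (𝓡 3) ∞ h s) {q : ℝ × V} (hq : q.2 ∈ s) (hqU : (q.1, h q.2) ∈ U) :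
    ContDiffAt ℝ ∞ (fun q : ℝ × V => (β q.1).pull h q.2) q := by
  refine ConicGray.contDiffAt_clm_apply_iff.2 fun w => ?_
  have hopen : IsOpen {p : ℝ × TangentBundle (𝓡 3) S3 | (p.1, p.2.1) ∈ U} :=
    hU.preimage (continuous_fst.prodMk ((FiberBundle.continuous_proj _ _).comp continuous_snd))
  have h1 := hh.contMDiffOn_tangentMapWithin (m := ∞) (by simp) hs.uniqueMDiffOn
  have h2 : ContMDiff 𝓘(ℝ, V) 𝓘(ℝ, V).tangent ∞
      (fun y : V => (⟨y, w⟩ : TangentBundle 𝓘(ℝ, V) V)) :=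
    contMDiff_vectorSpace_iff_contDiff.2 contDiff_const
  have h3 : ContMDiffAt 𝓘(ℝ, V) (𝓡 3).tangent ∞
      (fun y : V => tangentMapWithin 𝓘(ℝ, V) (𝓡 3) h s ⟨y, w⟩) q.2 :=
    (h1.comp h2.contMDiffOn (s := s) fun y hy => hy).contMDiffAt (hs.mem_nhds hq)
  have h4 : ContMDiffAt 𝓘(ℝ, ℝ × V) (𝓘(ℝ, ℝ).prod (𝓡 3).tangent) ∞
      (fun q : ℝ × V => (q.1, tangentMapWithin 𝓘(ℝ, V) (𝓡 3) h s ⟨q.2, w⟩)) q :=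
    contDiffAt_fst.contMDiffAt.prodMk (h3.comp q contDiffAt_snd.contMDiffAt)
  have h5 := (hβ.contMDiffAt (hopen.mem_nhds
    (show (q.1, tangentMapWithin 𝓘(ℝ, V) (𝓡 3) h s ⟨q.2, w⟩) ∈ _ from hqU))).comp q h4
  refine (h5.contDiffAt).congr_of_eventuallyEq ?_
  have h6 : ∀ᶠ q' : ℝ × V in 𝓝 q, q'.2 ∈ s := continuousAt_snd.eventually (hs.mem_nhds hq)
  filter_upwards [h6] with q' hq'
  change _ = β q'.1 (h q'.2) (mfderivWithin 𝓘(ℝ, V) (𝓡 3) h s q'.2 w)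
  rw [mfderivWithin_of_isOpen hs hq']
  rfl

end Pull

end InvContact

/-! ### Pulled back distributions, exterior derivatives and contact linear algebra. -/

namespace InvContact

open Set Filter
open scoped Topology RealInnerProductSpace

section PullDistribution

variable {F H M : Type*} [NormedAddCommGroup F] [NormedSpace ℝ F] [TopologicalSpace H]
  {I : ModelWithCorners ℝ F H} [TopologicalSpace M] [ChartedSpace H M]
  {F' H' M' : Type*} [NormedAddCommGroup F'] [NormedSpace ℝ F'] [TopologicalSpace H']
  {I' : ModelWithCorners ℝ F' H'} [TopologicalSpace M'] [ChartedSpace H' M']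

variable (I) in
/-- The preimage of a distribution under the differential of a map `h`. -/
noncomputable def Distribution.pull (η : Distribution) (h : M → S3) (y : M) :
    Submodule ℝ (TangentSpace I y) :=
  (η (h y)).comap (mfderiv I (𝓡 3) h y).toLinearMap

lemma Distribution.mem_pull {η : Distribution} {h : M → S3} {y : M} {w : TangentSpace I y} :
    w ∈ η.pull I h y ↔ mfderiv I (𝓡 3) h y w ∈ η (h y) := Iff.rfl

lemma Distribution.pull_congr (η : Distribution) {h h' : M → S3} {y : M} (hh : h =ᶠ[𝓝 y] h') :
    η.pull I h y = η.pull I h' y := by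
  let η' : S3 → Submodule ℝ (EuclideanSpace ℝ (Fin 3)) := η
  have h1 : (mfderiv I (𝓡 3) h y : TangentSpace I y →L[ℝ] EuclideanSpace ℝ (Fin 3)) =
      mfderiv I (𝓡 3) h' y := hh.mfderiv_eq
  ext w
  change (mfderiv I (𝓡 3) h y : TangentSpace I y →L[ℝ] EuclideanSpace ℝ (Fin 3)) w ∈ η' (h y) ↔
    (mfderiv I (𝓡 3) h' y : TangentSpace I y →L[ℝ] EuclideanSpace ℝ (Fin 3)) w ∈ η' (h' y)
  rw [h1, hh.self_of_nhds]

lemma Distribution.mem_pull_comp (η : Distribution) {h : M' → S3} {f : M → M'} {y : M}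
    (hh : MDifferentiableAt I' (𝓡 3) h (f y)) (hf : MDifferentiableAt I I' f y)
    (w : TangentSpace I y) :
    w ∈ η.pull I (h ∘ f) y ↔ mfderiv I I' f y w ∈ η.pull I' h (f y) := by
  rw [mem_pull, mem_pull, mfderiv_comp_apply y hh hf]
  rfl

lemma Distribution.mem_pull_id (η : Distribution) (x : S3) (v : TS x) :
    v ∈ η.pull (𝓡 3) (id : S3 → S3) x ↔ v ∈ η x := by
  rw [mem_pull, mfderiv_id]
  rfl

end PullDistribution

section ExteriorDerivative

/-- The exterior derivative of a `1`-form commutes with pullback. -/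
lemma fderiv_pullback_sub {V V' : Type*} [NormedAddCommGroup V] [NormedSpace ℝ V]
    [NormedAddCommGroup V'] [NormedSpace ℝ V'] {a : V' → V' →L[ℝ] ℝ} {f : V → V'} {y : V}
    {A : V → V →L[ℝ] ℝ} (ha : DifferentiableAt ℝ a (f y)) (hf : ContDiffAt ℝ ∞ f y)
    (hA : A =ᶠ[𝓝 y] fun z => (a (f z)).comp (fderiv ℝ f z)) (v w : V) :
    fderiv ℝ A y v w - fderiv ℝ A y w v =
      fderiv ℝ a (f y) (fderiv ℝ f y v) (fderiv ℝ f y w) -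
        fderiv ℝ a (f y) (fderiv ℝ f y w) (fderiv ℝ f y v) := by
  have h1 : HasFDerivAt f (fderiv ℝ f y) y := (hf.differentiableAt (by simp)).hasFDerivAt
  have h2 : HasFDerivAt (fderiv ℝ f) (fderiv ℝ (fderiv ℝ f) y) y :=
    ((hf.fderiv_right (m := ∞) (by simp)).differentiableAt (by simp)).hasFDerivAt
  have h3 : HasFDerivAt (fun z => a (f z)) ((fderiv ℝ a (f y)).comp (fderiv ℝ f y)) y :=
    HasFDerivAt.comp y ha.hasFDerivAt h1
  have h4 := (h3.clm_comp h2).congr_of_eventuallyEq hA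
  have hs : IsSymmSndFDerivAt ℝ f y := hf.isSymmSndFDerivAt ConicGray.two_le_smooth
  rw [h4.fderiv]
  simp [hs.eq v w]

variable {γ : OneForm}

lemma OneForm.Smooth.contDiffAt_pull (hγ : γ.Smooth) {V : Type*} [NormedAddCommGroup V]
    [NormedSpace ℝ V] [FiniteDimensional ℝ V] {h : V → S3} {s : Set V} (hs : IsOpen s)
    (hh : ContMDiffOn 𝓘(ℝ, V) (𝓡 3) ∞ h s) {y : V} (hy : y ∈ s) :
    ContDiffAt ℝ ∞ (γ.pull h) y := by
  have h1 := OneForm.contDiffAt_pull (β := fun _ => γ) (U := univ) isOpen_univ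
    (hγ.comp contMDiff_snd).contMDiffOn hs hh (q := ((0 : ℝ), y)) hy (mem_univ _)
  exact h1.comp (f := fun z => ((0 : ℝ), z)) y (contDiffAt_const.prodMk contDiffAt_id)

lemma contMDiffOn_proj : ContMDiffOn 𝓘(ℝ, E4) (𝓡 3) ∞ proj {0}ᶜ := fun _ hy =>
  (contMDiffAt_proj hy).contMDiffWithinAt

/-- The exterior derivative of a form on `S³`, computed in `ℝ⁴`. -/
lemma OneForm.Smooth.d_mfderiv_proj (hγ : γ.Smooth) {y : E4} (hy : y ≠ 0) (v w : E4) :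
    γ.d (proj y) (mfderiv 𝓘(ℝ, E4) (𝓡 3) proj y v) (mfderiv 𝓘(ℝ, E4) (𝓡 3) proj y w) =
      fderiv ℝ (γ.pull proj) y v w - fderiv ℝ (γ.pull proj) y w v := by
  set x := proj y with hx
  let φ := extChartAt (𝓡 3) x
  let f : E4 → EuclideanSpace ℝ (Fin 3) := φ ∘ proj
  have hφ : ContMDiffAt (𝓡 3) 𝓘(ℝ, EuclideanSpace ℝ (Fin 3)) ∞ φ (proj y) :=
    contMDiffAt_extChartAt
  have hf : ContDiffAt ℝ ∞ f y := (hφ.comp y (contMDiffAt_proj hy)).contDiffAt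
  have hφo : IsOpen φ.target := isOpen_extChartAt_target x
  have hfy : f y ∈ φ.target := φ.map_source (mem_extChartAt_source x)
  have hφs : ContMDiffOn 𝓘(ℝ, EuclideanSpace ℝ (Fin 3)) (𝓡 3) ∞ φ.symm φ.target :=
    contMDiffOn_extChartAt_symm x
  have ha : DifferentiableAt ℝ (γ.pull φ.symm) (f y) :=
    (hγ.contDiffAt_pull hφo hφs hfy).differentiableAt (by simp)
  -- Locally `proj` is the inverse chart composed with `f`, so the pullback to `ℝ⁴` is the pullback
  -- by `f` of the chart expression that defines `OneForm.d`.
  have hA : γ.pull proj =ᶠ[𝓝 y] fun z => (γ.pull φ.symm (f z)).comp (fderiv ℝ f z) := by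
    have h1 : ∀ᶠ z in 𝓝 y, proj z ∈ φ.source :=
      (contMDiffAt_proj hy).continuousAt.eventually (extChartAt_source_mem_nhds x)
    have h2 : ∀ᶠ z in 𝓝 y, MDifferentiableAt 𝓘(ℝ, E4) 𝓘(ℝ, EuclideanSpace ℝ (Fin 3)) f z := by
      filter_upwards [h1, eventually_ne_nhds hy] with z hz hz0
      refine MDifferentiableAt.comp z ?_ (mdifferentiableAt_proj hz0)
      exact mdifferentiableAt_extChartAt (by rwa [← extChartAt_source (𝓡 3)])
    filter_upwards [eventually_eventually_nhds.2 h1, h2] with z hz1 hz2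
    have h3 : proj =ᶠ[𝓝 z] φ.symm ∘ f := by
      filter_upwards [hz1] with z' hz' using (φ.left_inv hz').symm
    rw [γ.pull_congr h3]
    refine γ.pull_comp ?_ hz2.differentiableAt
    have h4 : f z ∈ φ.target := φ.map_source hz1.self_of_nhds
    exact (hφs.contMDiffAt (hφo.mem_nhds h4)).mdifferentiableAt (by simp)
  rw [fderiv_pullback_sub ha hf hA v w]
  have hd : ∀ u : E4, fderiv ℝ f y u =
      mvfderiv (𝓡 3) φ x (mfderiv 𝓘(ℝ, E4) (𝓡 3) proj y u) := fun u => by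
    have := mfderiv_comp_apply y (hφ.mdifferentiableAt (by simp)) (mdifferentiableAt_proj hy) u
    rw [mfderiv_eq_fderiv] at this
    exact this
  rw [hd v, hd w]
  rfl

end ExteriorDerivative

section ContactLinearAlgebra

lemma finrank_TS (x : S3) : Module.finrank ℝ (TS x) = 3 :=
  (finrank_euclideanSpace_fin : Module.finrank ℝ (EuclideanSpace ℝ (Fin 3)) = 3)

instance (x : S3) : FiniteDimensional ℝ (TS x) :=
  inferInstanceAs (FiniteDimensional ℝ (EuclideanSpace ℝ (Fin 3)))

/-- A basis of the tangent space is positively oriented, up to exchanging two vectors. -/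
lemma posOriented_or_swap {x : S3} {v : Fin 3 → TS x} (hv : LinearIndependent ℝ v) :
    PosOriented x (v 0) (v 1) (v 2) ∨ PosOriented x (v 1) (v 0) (v 2) := by
  let R : Fin 4 → E4 := ![(x : E4), dIncl x (v 0), dIncl x (v 1), dIncl x (v 2)]
  let N : Matrix (Fin 4) (Fin 4) ℝ := Matrix.of fun i j => R i j
  have hR : LinearIndependent ℝ R := by
    have h1 : LinearIndependent ℝ (fun i => dIncl x (v i)) :=
      hv.map' (dIncl x).toLinearMap (LinearMap.ker_eq_bot.2 (dIncl_injective x))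
    have h2 : R = Fin.cons (x : E4) (fun i => dIncl x (v i)) := by
      funext i
      fin_cases i <;> rfl
    rw [h2, linearIndependent_finCons]
    refine ⟨h1, fun hmem => ?_⟩
    have h3 : Submodule.span ℝ (range fun i => dIncl x (v i)) ≤ (ℝ ∙ (x : E4))ᗮ := by
      rw [Submodule.span_le]
      rintro _ ⟨i, rfl⟩
      exact Submodule.mem_orthogonal_singleton_iff_inner_right.2 (inner_dIncl x (v i))
    have h4 := Submodule.mem_orthogonal_singleton_iff_inner_right.1 (h3 hmem)
    exact coe_ne_zero x (inner_self_eq_zero.1 h4)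
  have hdet : N.det ≠ 0 := by
    have h1 : LinearIndependent ℝ N.row :=
      hR.map' (WithLp.linearEquiv 2 ℝ (Fin 4 → ℝ)).toLinearMap (LinearEquiv.ker _)
    exact ((Matrix.isUnit_iff_isUnit_det _).1
      (Matrix.linearIndependent_rows_iff_isUnit.1 h1)).ne_zero
  rcases hdet.lt_or_gt with h | h
  · right
    have h1 : Matrix.of (fun i j : Fin 4 =>
        ![(x : E4), dIncl x (v 1), dIncl x (v 0), dIncl x (v 2)] i j) =
        N.submatrix (Equiv.swap 1 2) id := by
      ext i j
      fin_cases i <;> rfl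
    rw [PosOriented, h1, Matrix.det_permute, Equiv.Perm.sign_swap (by decide)]
    simpa using h
  · exact Or.inl h

variable {α : OneForm}

lemma OneForm.d_swap (α : OneForm) (x : S3) (v w : TS x) : α.d x v w = -α.d x w v := by
  simp [OneForm.d]

lemma OneForm.IsContact.exists_ne_zero (hα : α.IsContact) (x : S3) : ∃ v : TS x, α x v ≠ 0 := by
  by_contra! h
  let b := Module.finBasisOfFinrankEq ℝ (TS x) (finrank_TS x)
  have h1 : ∀ v₁ v₂ v₃, α.wedgeD x v₁ v₂ v₃ = 0 := fun v₁ v₂ v₃ => by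
    simp [OneForm.wedgeD, h]
  rcases posOriented_or_swap b.linearIndependent with h2 | h2
  · exact (hα.pos x _ _ _ h2).ne' (h1 _ _ _)
  · exact (hα.pos x _ _ _ h2).ne' (h1 _ _ _)

lemma OneForm.finrank_kernel {x : S3} (h : ∃ v : TS x, α x v ≠ 0) :
    Module.finrank ℝ (α.kernel x) = 2 := by
  have h0 : (α x).toLinearMap ≠ 0 := fun h0 => by
    obtain ⟨v, hv⟩ := h
    exact hv (congrArg (fun L : TS x →ₗ[ℝ] ℝ => L v) h0)
  have h1 := Module.Dual.finrank_ker_add_one_of_ne_zero (f := (α x).toLinearMap) h0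
  rw [finrank_TS] at h1
  change Module.finrank ℝ (LinearMap.ker (α x).toLinearMap) = 2
  omega

/-- The restriction of `dα` to the contact planes is nondegenerate. -/
lemma OneForm.IsContact.nondegenerate (hα : α.IsContact) {x : S3} {X : TS x} (hX : α x X = 0)
    (h : ∀ w, α x w = 0 → α.d x X w = 0) : X = 0 := by
  by_contra hX0
  obtain ⟨z, hz⟩ := hα.exists_ne_zero x
  -- A nonzero `X` extends to a basis `X, w, z` with `w` in the contact plane and `z` transverse.
  -- Then `α ∧ dα` evaluates to `α(z) dα(X, w) = 0` up to sign, contradicting positivity in one of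
  -- the two orders.
  obtain ⟨w, hw, hwX⟩ : ∃ w ∈ α.kernel x, w ∉ Submodule.span ℝ {X} := by
    by_contra! hc
    have h1 := Submodule.finrank_mono (show α.kernel x ≤ Submodule.span ℝ {X} from hc)
    rw [OneForm.finrank_kernel ⟨z, hz⟩, finrank_span_singleton hX0] at h1
    omega
  have hw0 : α x w = 0 := hw
  have hli : LinearIndependent ℝ ![X, w, z] := by
    rw [Fintype.linearIndependent_iff]
    intro g hg
    simp only [Fin.sum_univ_three, Matrix.cons_val_zero, Matrix.cons_val_one,
      Matrix.cons_val_two] at hg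
    have h2 : g 2 = 0 := by
      have := congrArg (α x) hg
      simpa [hX, hw0, hz] using this
    have h1 : g 1 = 0 := by
      by_contra h1
      refine hwX (Submodule.mem_span_singleton.2 ⟨-((g 1)⁻¹ * g 0), ?_⟩)
      have h3 : g 0 • X + g 1 • w = 0 := by simpa [h2] using hg
      have h4 : w = (g 1)⁻¹ • (g 1 • w) := by rw [inv_smul_smul₀ h1]
      rw [h4, eq_neg_of_add_eq_zero_right h3, smul_neg, smul_smul, neg_smul]
    have h0 : g 0 = 0 := by simpa [h2, h1, hX0] using hg
    intro i
    fin_cases i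
    · exact h0
    · exact h1
    · exact h2
  have hd : α.d x X w = 0 := h w hw0
  have hd' : α.d x w X = 0 := by rw [α.d_swap, hd, neg_zero]
  rcases posOriented_or_swap hli with h2 | h2
  · have := hα.pos x _ _ _ h2
    simp [OneForm.wedgeD, hX, hw0, hd] at this
  · have := hα.pos x _ _ _ h2
    simp [OneForm.wedgeD, hX, hw0, hd'] at this

end ContactLinearAlgebra

end InvContact

/-! ### From the sphere to the cone and back. -/

namespace InvContact

open Set Filter
open scoped Topology RealInnerProductSpace

/-- The family of hyperplane fields on `ℝ⁴ ∖ 0` induced by a family of plane fields on `S³`. -/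
noncomputable def coneDistribution (ξ : ℝ → Distribution) (q : ℝ × E4) : Submodule ℝ E4 :=
  (ξ q.1).pull 𝓘(ℝ, E4) proj q.2

lemma mem_coneDistribution {ξ : ℝ → Distribution} {t : ℝ} {y w : E4} :
    w ∈ coneDistribution ξ (t, y) ↔ mfderiv 𝓘(ℝ, E4) (𝓡 3) proj y w ∈ ξ t (proj y) := Iff.rfl

variable {u : S3 → S3} {ξ : ℝ → Distribution}

/-- Two kinds of forms play separate roles: the local `β` depends smoothly on time and supplies the
defining forms, while the contact form `α` at each fixed time supplies transversality and
nondegeneracy. -/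
lemma isConicContact (hξ : ∀ t ∈ Icc (0 : ℝ) 1, IsInvariantContactStructure u (ξ t))
    (hsmooth : IsSmoothFamily ξ) : ConicGray.IsConicContact (coneDistribution ξ) where
  exists_form t ht y hy := by
    obtain ⟨U, hU, hmem, β, hβ, hker⟩ := hsmooth t ht (proj y)
    have hc : ContinuousAt (fun q : ℝ × E4 => proj q.2) (t, y) :=
      ContinuousAt.comp (g := proj) (f := Prod.snd)
        (contMDiffAt_proj hy).continuousAt continuousAt_snd
    have h1 : ContinuousAt (fun q : ℝ × E4 => (q.1, proj q.2)) (t, y) :=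
      continuousAt_fst.prodMk hc
    have h2 : ∀ᶠ q : ℝ × E4 in 𝓝 (t, y), (q.1, proj q.2) ∈ U := h1.eventually (hU.mem_nhds hmem)
    have h3 : ∀ᶠ q : ℝ × E4 in 𝓝 (t, y), q.2 ≠ 0 :=
      (continuousAt_snd (p := (t, y))).eventually_ne hy
    refine ⟨fun q => (β q.1).pull proj q.2, ?_, ?_⟩
    · filter_upwards [h2, h3] with q hq hq0
      exact OneForm.contDiffAt_pull hU hβ isOpen_compl_singleton contMDiffOn_proj hq0 hq
    · filter_upwards [h2] with q hq hqt w
      have : ξ q.1 (proj q.2) = (β q.1).kernel (proj q.2) := hker q.1 hqt _ hq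
      rw [mem_coneDistribution, this]
      rfl
  conic t ht y hy c hc := by
    have hcy : c • y ≠ 0 := smul_ne_zero hc.ne' hy
    have h1 : proj ∘ (fun z : E4 => c • z) = proj := funext fun z => proj_smul hc z
    have hd : HasFDerivAt (fun z : E4 => c • z) (c • ContinuousLinearMap.id ℝ E4) y :=
      (hasFDerivAt_id y).const_smul c
    ext w
    have h2 := (ξ t).mem_pull_comp (f := fun z : E4 => c • z) (h := proj) (y := y)
      (mdifferentiableAt_proj hcy) hd.differentiableAt.mdifferentiableAt w
    rw [h1, mfderiv_eq_fderiv, hd.fderiv] at h2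
    refine Iff.trans ?_ h2.symm
    change w ∈ coneDistribution ξ (t, c • y) ↔ c • w ∈ coneDistribution ξ (t, c • y)
    exact (Submodule.smul_mem_iff _ hc.ne').symm
  radial t ht y hy := by
    rw [mem_coneDistribution, mfderiv_proj_radial hy]
    exact zero_mem _
  exists_notMem t ht y hy := by
    obtain ⟨α, hα, hk, -⟩ := hξ t ht
    obtain ⟨v, hv⟩ := hα.exists_ne_zero (proj y)
    obtain ⟨e, he⟩ := mfderiv_proj_surjective hy v
    refine ⟨e, fun h => hv ?_⟩
    rw [mem_coneDistribution, hk, he] at h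
    exact h
  nondegenerate t ht y hy := by
    obtain ⟨α, hα, hk, -⟩ := hξ t ht
    refine ⟨α.pull proj, ?_, Eventually.of_forall fun z w => ?_, fun X hX ho hc => ?_⟩
    · exact (hα.smooth.contDiffAt_pull isOpen_compl_singleton contMDiffOn_proj hy).differentiableAt
        (by simp)
    · rw [mem_coneDistribution, hk]
      rfl
    · rw [mem_coneDistribution, hk] at hX
      refine eq_zero_of_mfderiv_proj hy ho (hα.nondegenerate hX fun w' hw' => ?_)
      obtain ⟨w, rfl⟩ := mfderiv_proj_surjective hy w'
      have hw : w ∈ coneDistribution ξ (t, y) := by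
        rw [mem_coneDistribution, hk]
        exact hw'
      rw [hα.smooth.d_mfderiv_proj hy, hc w hw, sub_self]

/-- The extension of a self-map of `S³` to a homogeneous self-map of `ℝ⁴`. -/
noncomputable def coneMap (u : S3 → S3) (y : E4) : E4 := ‖y‖ • (u (proj y) : E4)

lemma coneMap_coe (x : S3) : coneMap u (x : E4) = u x := by
  simp [coneMap]

lemma norm_coneMap (y : E4) : ‖coneMap u y‖ = ‖y‖ := by
  simp [coneMap, norm_smul]

lemma proj_coneMap {y : E4} (hy : y ≠ 0) : proj (coneMap u y) = u (proj y) := by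
  rw [coneMap, proj_smul (norm_pos_iff.2 hy), proj_coe]

lemma contDiffAt_coneMap (hu : ContMDiff (𝓡 3) (𝓡 3) ∞ u) {y : E4} (hy : y ≠ 0) :
    ContDiffAt ℝ ∞ (coneMap u) y := by
  have h1 : ContMDiffAt 𝓘(ℝ, E4) 𝓘(ℝ, E4) ∞ (fun y => (u (proj y) : E4)) y :=
    (contMDiff_coe.comp hu).contMDiffAt.comp y (contMDiffAt_proj hy)
  exact (contDiffAt_norm ℝ hy).smul h1.contDiffAt

/-- Since `proj ∘ coneMap u = u ∘ proj` away from `0`, invariance of the planes under `u` lifts by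
the chain rule. -/
lemma isSymmetry_coneMap (hu : ContMDiff (𝓡 3) (𝓡 3) ∞ u) (hinv : Function.Involutive u)
    (hξ : ∀ t ∈ Icc (0 : ℝ) 1, ∀ x : S3,
      (ξ t (u x)).comap (mfderiv (𝓡 3) (𝓡 3) u x).toLinearMap = ξ t x) :
    ConicGray.IsSymmetry (coneDistribution ξ) (coneMap u) where
  smooth y hy := contDiffAt_coneMap hu hy
  involutive y hy := by
    rw [coneMap, norm_coneMap, proj_coneMap hy, hinv, norm_smul_proj hy]
  norm_eq y _ := norm_coneMap y
  mem_iff t ht y hy w := by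
    have hne : coneMap u y ≠ 0 := by
      rw [← norm_ne_zero_iff, norm_coneMap]
      exact norm_ne_zero_iff.2 hy
    have h1 : proj ∘ coneMap u =ᶠ[𝓝 y] u ∘ proj := by
      filter_upwards [eventually_ne_nhds hy] with z hz using proj_coneMap hz
    have h2 := (ξ t).mem_pull_comp (f := coneMap u) (h := proj) (y := y)
      (mdifferentiableAt_proj hne)
      ((contDiffAt_coneMap hu hy).differentiableAt (by simp)).mdifferentiableAt w
    have h3 := (ξ t).mem_pull_comp (f := proj) (h := u) (y := y)
      (hu.mdifferentiableAt (by simp)) (mdifferentiableAt_proj hy) w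
    rw [(ξ t).pull_congr h1, mfderiv_eq_fderiv] at h2
    refine Iff.trans ?_ (h3.symm.trans h2)
    rw [mem_coneDistribution, ← hξ t ht (proj y)]
    rfl

lemma finrank_of_contact {η : Distribution} (h : IsInvariantContactStructure u η) (x : S3) :
    Module.finrank ℝ (η x) = 2 := by
  obtain ⟨α, hα, rfl, -⟩ := h
  exact OneForm.finrank_kernel (hα.exists_ne_zero x)

lemma mem_coneDistribution_coe {t : ℝ} {x : S3} {v : TS x} (hv : v ∈ ξ t x) :
    dIncl x v ∈ coneDistribution ξ (t, (x : E4)) := by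
  have h1 : proj ∘ (fun z : S3 => (z : E4)) = id := funext proj_coe
  have h2 := (ξ t).mem_pull_comp (f := fun z : S3 => (z : E4)) (h := proj) (y := x)
    (mdifferentiableAt_proj (coe_ne_zero x)) (mdifferentiableAt_coe x) v
  rw [h1, Distribution.mem_pull_id] at h2
  exact h2.1 hv

lemma mfderiv_proj_comp {f : E4 → E4} {x : S3} (hf : DifferentiableAt ℝ f x) (hne : f x ≠ 0)
    (v : TS x) : mfderiv (𝓡 3) (𝓡 3) (fun z : S3 => proj (f z)) x v =
      mfderiv 𝓘(ℝ, E4) (𝓡 3) proj (f x) (fderiv ℝ f x (dIncl x v)) := by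
  have h1 : MDifferentiableAt (𝓡 3) 𝓘(ℝ, E4) (fun z : S3 => f z) x :=
    hf.mdifferentiableAt.comp x (mdifferentiableAt_coe x)
  have h2 := mfderiv_comp_apply x (g := proj) (f := fun z : S3 => f z)
    (mdifferentiableAt_proj hne) h1 v
  have h3 := mfderiv_comp_apply x (g := f) (f := fun z : S3 => (z : E4))
    hf.mdifferentiableAt (mdifferentiableAt_coe x) v
  rw [mfderiv_eq_fderiv] at h3
  refine h2.trans ?_
  exact congrArg (mfderiv 𝓘(ℝ, E4) (𝓡 3) proj (f x)) h3

lemma contMDiff_proj_comp {f : E4 → E4} (hf : ContDiff ℝ ∞ f) (hne : ∀ x : S3, f x ≠ 0) :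
    ContMDiff (𝓡 3) (𝓡 3) ∞ (fun z : S3 => proj (f z)) := fun x =>
  (contMDiffAt_proj (hne x)).comp x ((hf.contMDiff.comp contMDiff_coe) x)

theorem exists_equivariant_isotopy (infty : S3) (u : S3 → S3)
    (hu : IsAdmissibleInvolution infty u)
    (ξ : ℝ → Distribution)
    (hξ : ∀ t ∈ Set.Icc (0 : ℝ) 1, IsInvariantContactStructure u (ξ t))
    (hsmooth : IsSmoothFamily ξ) :
    ∃ ψ : ℝ → S3 → S3,
      IsEquivariantIsotopy u ψ ∧
      ∀ t ∈ Set.Icc (0 : ℝ) 1, ∀ x : S3,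
        (ξ 0 x).map (mfderiv (𝓡 3) (𝓡 3) (ψ t) x).toLinearMap = ξ t (ψ t x) := by
  obtain ⟨Ψ, Ψinv, hs, hsi, hl, hr, h0, hn, hD, hU⟩ := (isConicContact hξ hsmooth).exists_isotopy
  have hsym : ConicGray.IsSymmetry (coneDistribution ξ) (coneMap u) :=
    isSymmetry_coneMap hu.smooth hu.involutive fun t ht => by
      obtain ⟨α, -, -, h, -⟩ := hξ t ht
      exact h
  have hx1 : ∀ x : S3, ‖(x : E4)‖ = 1 := norm_eq_of_mem_sphere
  have hn1 : ∀ t (x : S3), ‖Ψ t x‖ = 1 := fun t x => (hn t x).trans (hx1 x)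
  have hni : ∀ t (x : S3), ‖Ψinv t x‖ = 1 := fun t x => by rw [← hn t, hr, hx1]
  have hne : ∀ y : E4, ‖y‖ = 1 → y ≠ 0 := fun y hy h => by simp [h] at hy
  have hst : ∀ t, ContDiff ℝ ∞ (Ψ t) := fun t =>
    hs.comp (contDiff_const.prodMk contDiff_id : ContDiff ℝ ∞ fun y : E4 => (t, y))
  let ψ : ℝ → S3 → S3 := fun t x => proj (Ψ t x)
  have hdiffeo : ∀ t, ∃ Φ : S3 ≃ₘ^∞⟮𝓡 3, 𝓡 3⟯ S3, ⇑Φ = ψ t := fun t =>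
    ⟨{ toFun := ψ t
       invFun := fun x => proj (Ψinv t x)
       left_inv := fun x => by
        simp only [ψ]
        rw [coe_proj_of_norm_eq_one (hn1 t x), hl, proj_coe]
       right_inv := fun x => by
        simp only [ψ]
        rw [coe_proj_of_norm_eq_one (hni t x), hr, proj_coe]
       contMDiff_toFun := contMDiff_proj_comp (hst t) fun x => hne _ (hn1 t x)
       contMDiff_invFun := contMDiff_proj_comp (hsi t) fun x => hne _ (hni t x) }, rfl⟩
  refine ⟨ψ, ⟨⟨univ, isOpen_univ, subset_univ _, ?_⟩, fun t _ => hdiffeo t, ?_, ?_⟩, ?_⟩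
  · refine ContMDiff.contMDiffOn fun p => ?_
    have h1 : ContMDiff (𝓘(ℝ, ℝ).prod (𝓡 3)) 𝓘(ℝ, ℝ × E4) ∞
        (fun p : ℝ × S3 => (p.1, (p.2 : E4))) :=
      contMDiff_fst.prodMk_space (contMDiff_coe.comp contMDiff_snd)
    exact (contMDiffAt_proj (hne _ (hn1 p.1 p.2))).comp p ((hs.contMDiff.comp h1) p)
  · funext x
    simp [ψ, h0]
  · intro t ht
    funext x
    have h1 := hU _ hsym x (hx1 x) t ht
    rw [coneMap_coe] at h1
    simp only [Function.comp_apply, ψ]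
    rw [h1, proj_coneMap (hne _ (hn1 t x))]
  · intro t ht x
    have hd := (hst t).differentiable (by simp) (x : E4)
    have hle : (ξ 0 x).map (mfderiv (𝓡 3) (𝓡 3) (ψ t) x).toLinearMap ≤ ξ t (ψ t x) := by
      rintro _ ⟨v, hv, rfl⟩
      have h1 := hD x (hx1 x) _ (mem_coneDistribution_coe hv) t ht
      rw [mem_coneDistribution, ← mfderiv_proj_comp hd (hne _ (hn1 t x))] at h1
      exact h1
    -- The flow yields only an inclusion; both sides are planes, since the differential of a
    -- diffeomorphism is injective.
    refine Submodule.eq_of_le_of_finrank_eq hle ?_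
    obtain ⟨Φ, hΦ⟩ := hdiffeo t
    have hinj : Function.Injective (mfderiv (𝓡 3) (𝓡 3) (ψ t) x).toLinearMap := by
      rw [← hΦ]
      exact (Φ.mfderivToContinuousLinearEquiv (by simp) x).injective
    rw [← (Submodule.equivMapOfInjective _ hinj (ξ 0 x)).finrank_eq, finrank_of_contact (hξ t ht),
      finrank_of_contact (hξ 0 ⟨le_rfl, zero_le_one⟩)]

end InvContact

theorem proposition2p2 (infty : InvContact.S3) (u : InvContact.S3 → InvContact.S3)
    (hu : InvContact.IsAdmissibleInvolution infty u)
    (ξ : ℝ → InvContact.Distribution)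
    (hξ : ∀ t ∈ Set.Icc (0 : ℝ) 1, InvContact.IsInvariantContactStructure u (ξ t))
    (hsmooth : InvContact.IsSmoothFamily ξ) :
    ∃ ψ : ℝ → InvContact.S3 → InvContact.S3,
      InvContact.IsEquivariantIsotopy u ψ ∧
      ∀ t ∈ Set.Icc (0 : ℝ) 1, ∀ x : InvContact.S3,
        (ξ 0 x).map (mfderiv (𝓡 3) (𝓡 3) (ψ t) x).toLinearMap = ξ t (ψ t x) :=
  InvContact.exists_equivariant_isotopy infty u hu ξ hξ hsmooth
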